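/- Fix $k\ge 1$ and color the nonnegative integers with colors $1,\dots,k$, ordering the colored integers by $0_1\prec 0_2\prec\cdots\prec 0_k\prec 1_1\prec 1_2\prec\cdots\prec 1_k\prec 2_1\prec\cdots$. A $k$-colored generalized Frobenius partition of $n$ is a two-row array of colored integers $\begin{pmatrix} a_1,a_2,\dots,a_r\\ b_1,b_2,\dots,b_r\end{pmatrix}$ ($r\ge 0$) with $a_r\prec\cdots\prec a_2\prec a_1$, $b_r\prec\cdots\prec b_2\prec b_1$ and $n=r+\sum_{i=1}^r(a_i+b_i)$, where the sum is taken over the underlying integers. Let $c\phi_k(n)$ be the number of $k$-colored generalized Frobenius partitions of $n$. Theorem. For every integer $n\ge 0$, \begin{align*} c\phi_3(3n+1)&\equiv 0 \pmod{3^2}, & c\phi_3(3n+2)&\equiv 0 \pmod{3^3},\\ c\phi_3(9n+5)&\equiv 0 \pmod{3^5}, & c\phi_3(9n+8)&\equiv 0 \pmod{3^7},\\ c\phi_3(27n+17)&\equiv 0 \pmod{3^8}, & c\phi_3(27n+26)&\equiv 0 \pmod{3^9},\\ c\phi_3(81n+44)&\equiv 0 \pmod{3^{10}}, & c\phi_3(81n+71)&\equiv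 0 \pmod{3^{12}},\\ c\phi_3(243n+152)&\equiv 0 \pmod{3^{13}}, & c\phi_3(243n+233)&\equiv 0 \pmod{3^{14}}. \end{align*} -/

import Mathlib

/-- A nonnegative integer `a` in one of `k` colors, i.e. a pair `a_c` with `c` a color.
The order is lexicographic, first by the integer and then by the color:
`0_1 ≺ 0_2 ≺ ⋯ ≺ 0_k ≺ 1_1 ≺ ⋯ ≺ 1_k ≺ 2_1 ≺ ⋯`. -/
abbrev ColoredNat (k : ℕ) : Type := ℕ ×ₗ Fin k

/-- The underlying integer of a colored integer. -/
def ColoredNat.value {k : ℕ} (a : ColoredNat k) : ℕ := (ofLex a).1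

/-- A `k`-colored generalized Frobenius partition: a two-row array of colored integers with
rows of the same length, each row strictly decreasing in the order `≺`. -/
structure ColoredFrobeniusPartition (k : ℕ) where
  top : List (ColoredNat k)
  bottom : List (ColoredNat k)
  length_eq : top.length = bottom.length
  top_decreasing : top.Pairwise (· > ·)
  bottom_decreasing : bottom.Pairwise (· > ·)

/-- The number being partitioned: `r + ∑ (a_i + b_i)`, where `r` is the number of columns. -/
def ColoredFrobeniusPartition.size {k : ℕ} (π : ColoredFrobeniusPartition k) : ℕ :=
  π.top.length + ((π.top.map ColoredNat.value).sum + (π.bottom.map ColoredNat.value).sum)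

/-- There are finitely many `k`-colored generalized Frobenius partitions of `n`, so that
counting them with `Nat.card` gives their true number. -/
theorem ColoredFrobeniusPartition.finite_size_eq (k n : ℕ) :
    Finite {π : ColoredFrobeniusPartition k // π.size = n} := by
  let s : Finset (ColoredNat k) :=
    (Finset.range (n + 1) ×ˢ (Finset.univ : Finset (Fin k))).map toLex.toEmbedding
  have hs : ∀ l : List (ColoredNat k), (l.map ColoredNat.value).sum ≤ n →
      l.toFinset ∈ s.powerset := by
    intro l hl
    rw [Finset.mem_powerset]
    intro a ha
    have h1 : a.value ≤ (l.map ColoredNat.value).sum :=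
      List.single_le_sum (by simp) _ (List.mem_map_of_mem (List.mem_toFinset.mp ha))
    have h2 : (ofLex a).1 ≤ n := h1.trans hl
    simp only [s, Finset.mem_map, Finset.mem_product, Finset.mem_range, Finset.mem_univ,
      and_true]
    exact ⟨ofLex a, by omega, rfl⟩
  have hinj : ∀ l l' : List (ColoredNat k), l.Pairwise (· > ·) → l'.Pairwise (· > ·) →
      l.toFinset = l'.toFinset → l = l' := by
    intro l l' h h' e
    have hp : l.Perm l' := by
      rw [List.perm_ext_iff_of_nodup (h.imp (fun h => ne_of_gt h)) (h'.imp (fun h => ne_of_gt h))]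
      intro a
      rw [← List.mem_toFinset, e, List.mem_toFinset]
    exact hp.eq_of_pairwise (fun a b _ _ h1 h2 => absurd h1 (lt_asymm h2)) h h'
  refine Finite.of_injective
    (β := {t // t ∈ s.powerset} × {t // t ∈ s.powerset})
    (fun π => (⟨π.1.top.toFinset, hs _ ?_⟩, ⟨π.1.bottom.toFinset, hs _ ?_⟩)) ?_
  · have := π.2
    unfold ColoredFrobeniusPartition.size at this
    omega
  · have := π.2
    unfold ColoredFrobeniusPartition.size at this
    omega
  · rintro ⟨⟨t, b, hl, ht, hb⟩, h⟩ ⟨⟨t', b', hl', ht', hb'⟩, h'⟩ e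
    simp only [Prod.mk.injEq, Subtype.mk.injEq] at e
    obtain rfl := hinj _ _ ht ht' e.1
    obtain rfl := hinj _ _ hb hb' e.2
    rfl

/-- `cphi k n` is the number of `k`-colored generalized Frobenius partitions of `n`. -/
noncomputable def cphi (k n : ℕ) : ℕ :=
  Nat.card {π : ColoredFrobeniusPartition k // π.size = n}

/-! Write `E(q) = ∏ (1 - qⁱ)` and `a(q) = ∑ q^(x² + xy + y²)`. An array is a choice of factors in a
product `∏ (1 + z q^(n+1))(1 + z⁻¹ qⁿ)` taken once for each color, so the generating function is the
constant term in `z` of its cube; by Jacobi's triple product this is `a(q) / E(q)³`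
(`euler_cube_mul_mk_cphi`).

Put `C(q) = E(q³)³ / E(q)`, `A = a(q³)` and `D = q C(q³)`. Cubic theta function identities give
`a(q) = A + 6D` and `E(q)³ = E(q³) (A - 3D)`. Multiplying the latter over `q ↦ ωq` evaluates `A³ -
27D³`, whence `1 / E(q)³` is a series in `q³` times `S = A² + 3AD + 9D²` (`eulerInv_cube`). Since
`q` enters a monomial `Aᵐ Dʲ` only as `qʲ` times a series in `q³`, extracting the exponents `3n + s`
keeps exactly the `j ≡ s` mod 3. The result is again an eta quotient times a polynomial in `a` and
`W = q C³`, and `W = D S` turns it back into a polynomial in `A` and `D`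
(`dissect_quotientForm_monomial`).

The theorem thus reduces to 3-adic divisibility of polynomial coefficients along the residues 2, 2,
1, 2. The powers split off are `3³`, `3⁴`, `3`, `3⁴`; the side branches and the last extraction give
the remaining congruences. Everything is needed only modulo `3¹⁴`, which keeps the polynomials
manageable. -/

namespace ColoredFrobenius

open PowerSeries Finset

/-! ### Finite form of the Jacobi triple product. -/

section Theta

variable {K : Type*} [CommRing K]

/-- The finite Euler product `(1 - q)(1 - q²)⋯(1 - qⁿ)`. -/
noncomputable def qPoch (K : Type*) [CommRing K] (n : ℕ) : K⟦X⟧ :=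
  ∏ i ∈ range n, (1 - X ^ (i + 1))

theorem qPoch_succ (n : ℕ) : qPoch K (n + 1) = qPoch K n * (1 - X ^ (n + 1)) :=
  prod_range_succ _ _

/-- The infinite Euler product `∏ (1 - qⁱ)` as a formal power series. -/
noncomputable def euler (K : Type*) [CommRing K] : K⟦X⟧ :=
  PowerSeries.mk fun n => coeff n (qPoch K n)

theorem coeff_qPoch_of_le {m n : ℕ} (h : m ≤ n) :
    coeff m (qPoch K n) = coeff m (qPoch K m) := by
  induction n, h using Nat.le_induction with
  | base => rfl
  | succ n hn ih =>
    rw [qPoch_succ, mul_sub, mul_one, map_sub, ih, coeff_mul_X_pow', if_neg (by omega), sub_zero]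

theorem X_pow_dvd_euler_sub_qPoch {M n : ℕ} (h : M ≤ n + 1) :
    (X : K⟦X⟧) ^ M ∣ euler K - qPoch K n := by
  rw [X_pow_dvd_iff]
  intro m hm
  rw [map_sub, euler, coeff_mk, coeff_qPoch_of_le (by omega : m ≤ n), sub_self]

theorem constantCoeff_qPoch (n : ℕ) : constantCoeff (qPoch K n) = 1 := by
  simp [qPoch, map_prod]

theorem constantCoeff_euler : constantCoeff (euler K) = 1 := by
  rw [← coeff_zero_eq_constantCoeff_apply, euler, coeff_mk, coeff_zero_eq_constantCoeff_apply,
    constantCoeff_qPoch]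

theorem isUnit_euler : IsUnit (euler K) := by
  rw [PowerSeries.isUnit_iff_constantCoeff, constantCoeff_euler]
  exact isUnit_one

theorem isUnit_qPoch (n : ℕ) : IsUnit (qPoch K n) := by
  rw [PowerSeries.isUnit_iff_constantCoeff, constantCoeff_qPoch]
  exact isUnit_one

/-- `tri m = m (m + 1) / 2` -/
def tri (m : ℤ) : ℕ := (m * (m + 1) / 2).toNat

theorem two_mul_tri (m : ℤ) : (2 * tri m : ℤ) = m * (m + 1) := by
  have h0 : 0 ≤ m * (m + 1) := by
    rcases le_or_gt 0 m with h | h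
    · positivity
    · nlinarith
  have h2 : (2 : ℤ) ∣ m * (m + 1) := (Int.even_mul_succ_self m).two_dvd
  rw [tri, Int.toNat_of_nonneg (by omega)]
  omega

/-- The truncated Jacobi triple product `∏ (1 + z qⁿ⁺¹)(z + qⁿ)` over `n < N`, a polynomial
in `z` with power series coefficients. -/
noncomputable def thetaPoly (K : Type*) [CommRing K] (N : ℕ) : Polynomial K⟦X⟧ :=
  (∏ n ∈ range N, (1 + Polynomial.C (X ^ (n + 1)) * Polynomial.X)) *
    ∏ n ∈ range N, (Polynomial.X + Polynomial.C (X ^ n))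

/-- Both products telescope under `z ↦ qz`. The common factor `1 + qz` is kept on both sides to
avoid division, and is cancelled in `thetaPoly_coeff_succ`. -/
theorem thetaPoly_comp (N : ℕ) :
    ((thetaPoly K N).comp (Polynomial.C X * Polynomial.X) *
      (Polynomial.C X * Polynomial.X + Polynomial.C (X ^ N))) * (1 + Polynomial.C X * Polynomial.X)
    = (Polynomial.C (X ^ N) * (1 + Polynomial.C (X ^ (N + 1)) * Polynomial.X) * thetaPoly K N) *
      (1 + Polynomial.C X * Polynomial.X) := by
  have h1 : (∏ n ∈ range N, (1 + Polynomial.C ((X : K⟦X⟧) ^ (n + 1)) * Polynomial.X)).comp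
        (Polynomial.C X * Polynomial.X) * (1 + Polynomial.C X * Polynomial.X)
      = (∏ n ∈ range N, (1 + Polynomial.C (X ^ (n + 1)) * Polynomial.X)) *
        (1 + Polynomial.C (X ^ (N + 1)) * Polynomial.X) := by
    induction N with
    | zero => simp
    | succ N ih =>
      rw [prod_range_succ, Polynomial.mul_comp, mul_right_comm, ih]
      simp only [Polynomial.add_comp, Polynomial.one_comp, Polynomial.mul_comp,
        Polynomial.C_comp, Polynomial.X_comp, pow_succ, map_mul]
      ring
  have h2 : (∏ n ∈ range N, (Polynomial.X + Polynomial.C ((X : K⟦X⟧) ^ n))).comp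
        (Polynomial.C X * Polynomial.X) * (Polynomial.C X * Polynomial.X + Polynomial.C (X ^ N))
      = (∏ n ∈ range N, (Polynomial.X + Polynomial.C (X ^ n))) * Polynomial.C (X ^ N) *
        (1 + Polynomial.C X * Polynomial.X) := by
    clear h1
    induction N with
    | zero => simp; ring
    | succ N ih =>
      rw [prod_range_succ, Polynomial.mul_comp]
      simp only [Polynomial.add_comp, Polynomial.C_comp, Polynomial.X_comp]
      rw [ih]
      simp only [pow_succ, map_mul]
      ring
  rw [thetaPoly, Polynomial.mul_comp]
  linear_combination (Polynomial.comp (∏ n ∈ range N, (Polynomial.X + Polynomial.C ((X : K⟦X⟧) ^ n)))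
        (Polynomial.C X * Polynomial.X) * (Polynomial.C X * Polynomial.X + Polynomial.C (X ^ N))) * h1
      + (∏ n ∈ range N, (1 + Polynomial.C (X ^ (n + 1)) * Polynomial.X)) *
        (1 + Polynomial.C (X ^ (N + 1)) * Polynomial.X) * h2

theorem thetaPoly_coeff_zero (N : ℕ) : (thetaPoly K N).coeff 0 = X ^ tri (-N) := by
  have h : ∑ n ∈ range N, n = tri (-N) := by
    have h1 := Finset.sum_range_id_mul_two N
    have h2 := two_mul_tri (-N)
    rcases N with _ | N
    · simp [tri]
    · zify at h1 ⊢
      push_cast [Nat.add_sub_cancel] at h1 h2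
      linarith
  rw [Polynomial.coeff_zero_eq_eval_zero, thetaPoly, Polynomial.eval_mul, Polynomial.eval_prod,
    Polynomial.eval_prod, ← h, ← prod_pow_eq_pow_sum]
  simp

theorem natDegree_thetaPoly_le (N : ℕ) : (thetaPoly K N).natDegree ≤ 2 * N := by
  have h1 : (∏ n ∈ range N, (1 + Polynomial.C ((X : K⟦X⟧) ^ (n + 1)) * Polynomial.X)).natDegree
      ≤ N := by
    refine (Polynomial.natDegree_prod_le _ _).trans ((sum_le_card_nsmul _ _ 1 fun n _ => ?_).trans ?_)
    · compute_degree
    · simp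
  have h2 : (∏ n ∈ range N, (Polynomial.X + Polynomial.C ((X : K⟦X⟧) ^ n))).natDegree ≤ N := by
    refine (Polynomial.natDegree_prod_le _ _).trans ((sum_le_card_nsmul _ _ 1 fun n _ => ?_).trans ?_)
    · compute_degree
    · simp
  refine Polynomial.natDegree_mul_le.trans ?_
  omega

variable [IsDomain K]

theorem thetaPoly_coeff_succ (N j : ℕ) (hj : j ≤ 2 * N) :
    X ^ N * (1 - X ^ (j + 1)) * (thetaPoly K N).coeff (j + 1) =
      X ^ (j + 1) * (1 - X ^ (2 * N - j)) * (thetaPoly K N).coeff j := by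
  have hne : (1 + Polynomial.C (X : K⟦X⟧) * Polynomial.X) ≠ 0 := by
    intro h
    simpa using congrArg (fun p => Polynomial.coeff p 0) h
  have h := congrArg (fun p => Polynomial.coeff p (j + 1)) (mul_right_cancel₀ hne (thetaPoly_comp (K := K) N))
  simp only [mul_add, add_mul, mul_one, Polynomial.coeff_add, ← mul_assoc,
    Polynomial.coeff_mul_X, Polynomial.coeff_mul_C, Polynomial.coeff_C_mul,
    Polynomial.comp_C_mul_X_coeff] at h
  have h3 : Polynomial.coeff (Polynomial.C (X ^ N) * Polynomial.C ((X : K⟦X⟧) ^ (N + 1)) *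
      Polynomial.X * thetaPoly K N) (j + 1) = X ^ N * X ^ (N + 1) * (thetaPoly K N).coeff j := by
    rw [mul_assoc _ Polynomial.X, ← map_mul, Polynomial.coeff_C_mul, Polynomial.coeff_X_mul]
  rw [h3] at h
  have h4 : (X : K⟦X⟧) ^ (j + 1) * X ^ (2 * N - j) = X ^ N * X ^ (N + 1) := by
    rw [← pow_add, ← pow_add]; congr 1; omega
  linear_combination -h + (thetaPoly K N).coeff j * h4

/-- This is the q-binomial theorem: the coefficient of `zʲ` is a power of `q` times the Gaussian
binomial of `2N` over `j`. Induction on `j` uses the recurrence from the functional equation. -/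
theorem thetaPoly_coeff_mul (N j : ℕ) (hj : j ≤ 2 * N) :
    (thetaPoly K N).coeff j * (qPoch K j * qPoch K (2 * N - j)) =
      X ^ tri (j - N) * qPoch K (2 * N) := by
  induction j with
  | zero => simp [thetaPoly_coeff_zero, qPoch]
  | succ j ih =>
    have ih := ih (by omega)
    have h1 := thetaPoly_coeff_succ (K := K) N j (by omega)
    have h2 : qPoch K (2 * N - j) = qPoch K (2 * N - (j + 1)) * (1 - X ^ (2 * N - j)) := by
      conv_lhs => rw [show 2 * N - j = 2 * N - (j + 1) + 1 by omega, qPoch_succ]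
      rw [show 2 * N - (j + 1) + 1 = 2 * N - j by omega]
    have h3 : (X : K⟦X⟧) ^ N * X ^ tri ((j + 1 : ℕ) - N) = X ^ (j + 1) * X ^ tri (j - N) := by
      rw [← pow_add, ← pow_add]
      congr 1
      have e1 := two_mul_tri (j - N)
      have e2 := two_mul_tri ((j + 1 : ℕ) - N)
      push_cast at e2
      zify
      linarith
    have hX : (X : K⟦X⟧) ^ N ≠ 0 := pow_ne_zero _ X_ne_zero
    apply mul_left_cancel₀ hX
    rw [h2] at ih
    rw [qPoch_succ]
    linear_combination (qPoch K j * qPoch K (2 * N - (j + 1))) * h1 + X ^ (j + 1) * ih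
      - qPoch K (2 * N) * h3

theorem le_tri {M : ℕ} {m : ℤ} (h : (M : ℤ) + 1 ≤ |m|) : M ≤ tri m := by
  rcases Nat.eq_zero_or_pos M with rfl | hM
  · simp
  have e := two_mul_tri m
  have : (M : ℤ) * 2 ≤ m * (m + 1) := by
    rcases le_abs.mp h with h | h <;> nlinarith
  omega

/-- The coefficients of the truncated triple product tend to `q ^ (m (m + 1) / 2) / ∏ (1 - qⁱ)`. -/
theorem X_pow_dvd_euler_mul_coeff_sub {M N j : ℕ} (hN : 2 * M + 1 ≤ N) :
    (X : K⟦X⟧) ^ M ∣ euler K * (thetaPoly K N).coeff j - X ^ tri (j - N) := by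
  -- Near the centre, `j` and `2N - j` both exceed `M`, so all finite products agree with the
  -- infinite one modulo `q^M`. Away from it, both terms vanish modulo `q^M`.
  by_cases hjN : N ≤ j + M ∧ j ≤ N + M
  · have h := thetaPoly_coeff_mul (K := K) N j (by omega)
    obtain ⟨r1, h1⟩ := X_pow_dvd_euler_sub_qPoch (K := K) (M := M) (n := j) (by omega)
    obtain ⟨r2, h2⟩ := X_pow_dvd_euler_sub_qPoch (K := K) (M := M) (n := 2 * N - j) (by omega)
    obtain ⟨r3, h3⟩ := X_pow_dvd_euler_sub_qPoch (K := K) (M := M) (n := 2 * N) (by omega)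
    rw [← (isUnit_euler (K := K)).dvd_mul_left]
    refine ⟨(thetaPoly K N).coeff j * (r1 * euler K + qPoch K j * r2) - X ^ tri (j - N) * r3, ?_⟩
    linear_combination h + (thetaPoly K N).coeff j * (euler K * h1 + qPoch K j * h2)
      - X ^ tri (j - N) * h3
  · have h1 : (X : K⟦X⟧) ^ M ∣ X ^ tri (j - N) := by
      refine pow_dvd_pow _ (le_tri ?_)
      rw [le_abs]
      omega
    refine dvd_sub (dvd_mul_of_dvd_right ?_ _) h1
    rcases le_or_gt j (2 * N) with hj | hj
    · rw [← ((isUnit_qPoch (K := K) j).mul (isUnit_qPoch (2 * N - j))).dvd_mul_right,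
        thetaPoly_coeff_mul N j hj]
      exact dvd_mul_of_dvd_left h1 _
    · rw [Polynomial.coeff_eq_zero_of_natDegree_lt ((natDegree_thetaPoly_le N).trans_lt hj)]
      exact dvd_zero _

end Theta

/-! ### Theta series of `x² + xy + y²` from three triple products. -/

section QuadraticForm

/-- The representations of `n` by the form `x² + xy + y²`. -/
noncomputable def qfSet (n : ℕ) : Finset (ℤ × ℤ) :=
  (Icc (-n : ℤ) n ×ˢ Icc (-n : ℤ) n).filter fun p => p.1 ^ 2 + p.1 * p.2 + p.2 ^ 2 = n

theorem mem_qfSet {n : ℕ} {p : ℤ × ℤ} :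
    p ∈ qfSet n ↔ p.1 ^ 2 + p.1 * p.2 + p.2 ^ 2 = n := by
  have key : ∀ x y : ℤ, x ^ 2 + x * y + y ^ 2 = n → -n ≤ x ∧ x ≤ n := by
    intro x y h
    have h1 : 3 * x ^ 2 ≤ 4 * n := by nlinarith [sq_nonneg (x + 2 * y)]
    constructor <;> nlinarith
  rw [qfSet, mem_filter, mem_product, mem_Icc, mem_Icc, and_iff_right_iff_imp]
  exact fun h => ⟨key _ _ h, key p.2 p.1 (by linarith)⟩

theorem coeff_mul_mul_eq_sum {R : Type*} [CommRing R] (p q r : Polynomial R) {L : ℕ}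
    (hq : q.natDegree < L) (hr : r.natDegree < L) (n : ℕ) :
    (p * q * r).coeff n = ∑ j ∈ range L, ∑ k ∈ range L,
      if j + k ≤ n then p.coeff (n - (j + k)) * q.coeff j * r.coeff k else 0 := by
  conv_lhs => rw [mul_assoc, q.as_sum_range' L hq, r.as_sum_range' L hr, sum_mul_sum, mul_sum]
  rw [Polynomial.finsetSum_coeff]
  refine sum_congr rfl fun j _ => ?_
  rw [mul_sum, Polynomial.finsetSum_coeff]
  refine sum_congr rfl fun k _ => ?_
  rw [Polynomial.monomial_mul_monomial, ← Polynomial.C_mul_X_pow_eq_monomial, ← mul_assoc,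
    Polynomial.coeff_mul_X_pow', Polynomial.coeff_mul_C, ← mul_assoc]

variable {K : Type*} [CommRing K]

/-- The theta series of `x² + xy + y²`, with weights `uˣ vʸ` for cube roots of unity `u` and `v`. -/
noncomputable def qfSeries (u v : K) : K⟦X⟧ :=
  PowerSeries.mk fun n => ∑ p ∈ qfSet n, u ^ (p.1 % 3).toNat * v ^ (p.2 % 3).toNat

theorem pow_eq_pow_emod {u : K} (hu : u ^ 3 = 1) {N j : ℕ} (hN : 3 ∣ N) :
    u ^ j = u ^ (((j : ℤ) - N) % 3).toNat := by
  have h : (((j : ℤ) - N) % 3).toNat = j % 3 := by omega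
  rw [h]
  exact pow_eq_pow_mod j hu

variable [IsDomain K]

/-- The central coefficient of a product of three triple products is a theta series of the form
`x² + xy + y²`. -/
theorem X_pow_dvd_euler_cube_mul_coeff_sub {u v : K} (hu : u ^ 3 = 1) (hv : v ^ 3 = 1) {M N : ℕ}
    (hN : 2 * M + 1 ≤ N) (hN3 : 3 ∣ N) :
    (X : K⟦X⟧) ^ M ∣ euler K ^ 3 * (thetaPoly K N *
      (thetaPoly K N).comp (Polynomial.C (C u) * Polynomial.X) *
      (thetaPoly K N).comp (Polynomial.C (C v) * Polynomial.X)).coeff (3 * N) - qfSeries u v := by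
  have hdeg : ∀ w : K, ((thetaPoly K N).comp (Polynomial.C (C w) * Polynomial.X)).natDegree
      < 2 * N + 1 := by
    intro w
    refine Nat.lt_succ_of_le (Polynomial.natDegree_comp_le.trans ?_)
    calc _ ≤ (2 * N) * 1 := Nat.mul_le_mul (natDegree_thetaPoly_le N)
            (by compute_degree)
      _ = 2 * N := by ring
  rw [coeff_mul_mul_eq_sum _ _ _ (hdeg u) (hdeg v), ← Ideal.mem_span_singleton,
    ← Ideal.Quotient.eq]
  set π := Ideal.Quotient.mk (Ideal.span {(X : K⟦X⟧) ^ M}) with hπ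
  have hπE : ∀ j, π (euler K) * π ((thetaPoly K N).coeff j) = π (X ^ tri (j - N)) := by
    intro j
    rw [← map_mul, Ideal.Quotient.eq, Ideal.mem_span_singleton]
    exact X_pow_dvd_euler_mul_coeff_sub hN
  have hterm : ∀ j k : ℕ, π (euler K ^ 3 * (if j + k ≤ 3 * N then
        (thetaPoly K N).coeff (3 * N - (j + k)) *
        ((thetaPoly K N).comp (Polynomial.C (C u) * Polynomial.X)).coeff j *
        ((thetaPoly K N).comp (Polynomial.C (C v) * Polynomial.X)).coeff k else 0)) =
      π (C (u ^ j * v ^ k) *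
        X ^ (((j - N : ℤ) ^ 2 + (j - N) * (k - N) + (k - N) ^ 2).toNat)) := by
    intro j k
    have e1 := two_mul_tri (j - N)
    have e2 := two_mul_tri (k - N)
    have e3 := two_mul_tri (2 * N - j - k)
    -- With `x = j - N` and `y = k - N`, the third index is `-x - y`; the linear parts of the three
    -- triangular numbers cancel, leaving the form.
    have e4 : (((j - N : ℤ) ^ 2 + (j - N) * (k - N) + (k - N) ^ 2).toNat) =
        tri (2 * N - j - k) + tri (j - N) + tri (k - N) := by
      have : ((j - N : ℤ) ^ 2 + (j - N) * (k - N) + (k - N) ^ 2) =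
        tri (2 * N - j - k) + tri (j - N) + tri (k - N) := by linarith
      omega
    rw [e4, pow_add, pow_add]
    split_ifs with h
    · simp only [Polynomial.comp_C_mul_X_coeff, map_mul, map_pow]
      have h3 := hπE (3 * N - (j + k))
      rw [show (((3 * N - (j + k) : ℕ) : ℤ) - N) = 2 * N - j - k by omega] at h3
      rw [← map_pow π X, ← map_pow π X, ← map_pow π X, ← h3, ← hπE, ← hπE]
      ring
    · have h0 : π (X ^ tri (2 * N - j - k)) = 0 := by
        rw [Ideal.Quotient.eq_zero_iff_mem, Ideal.mem_span_singleton]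
        refine pow_dvd_pow _ (le_tri ?_)
        rw [le_abs]
        omega
      simp only [map_mul, h0]
      simp
  rw [mul_sum, map_sum]
  simp_rw [mul_sum, map_sum, hterm]
  simp_rw [← map_sum]
  rw [Ideal.Quotient.eq, Ideal.mem_span_singleton, X_pow_dvd_iff]
  intro m hm
  rw [map_sub, sub_eq_zero, map_sum, qfSeries, coeff_mk]
  simp_rw [map_sum, coeff_C_mul, coeff_X_pow]
  rw [← sum_product']
  simp_rw [mul_ite, mul_one, mul_zero]
  rw [← sum_filter]
  have hpos : ∀ x y : ℤ, 0 ≤ x ^ 2 + x * y + y ^ 2 := fun x y => by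
    nlinarith [sq_nonneg (x + 2 * y), sq_nonneg x]
  refine sum_bij' (fun p _ => ((p.1 : ℤ) - N, (p.2 : ℤ) - N))
    (fun p _ => ((p.1 + N).toNat, (p.2 + N).toNat)) ?_ ?_ ?_ ?_ ?_
  · rintro ⟨j, k⟩ h
    rw [mem_filter] at h
    rw [mem_qfSet]
    have := hpos (j - N) (k - N)
    simp only at h ⊢
    omega
  · rintro ⟨x, y⟩ h
    have h' : (x, y) ∈ Icc (-m : ℤ) m ×ˢ Icc (-m : ℤ) m := mem_of_mem_filter _ h
    rw [mem_qfSet] at h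
    simp only [mem_product, mem_Icc] at h'
    simp only [mem_filter, mem_product, mem_range]
    refine ⟨by omega, ?_⟩
    rw [Int.toNat_of_nonneg (by omega), Int.toNat_of_nonneg (by omega)]
    simp only [add_sub_cancel_right]
    simp only at h
    omega
  · rintro ⟨j, k⟩ h
    simp
  · rintro ⟨x, y⟩ h
    have h' : (x, y) ∈ Icc (-m : ℤ) m ×ˢ Icc (-m : ℤ) m := mem_of_mem_filter _ h
    simp only [mem_product, mem_Icc] at h'
    ext <;> simp only <;> omega
  · rintro ⟨j, k⟩ h
    rw [pow_eq_pow_emod hu hN3, pow_eq_pow_emod hv hN3]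

end QuadraticForm

/-! ### Products over cube roots of unity. -/

section Cube

variable {K : Type*} [CommRing K]

theorem X_pow_dvd_expand {M : ℕ} {f : K⟦X⟧} (h : X ^ M ∣ f) :
    X ^ M ∣ expand 3 three_ne_zero f := by
  obtain ⟨g, rfl⟩ := h
  rw [map_mul, map_pow, expand_X, ← pow_mul]
  exact dvd_mul_of_dvd_left (pow_dvd_pow _ (by omega)) _

theorem X_pow_dvd_rescale {M : ℕ} {f : K⟦X⟧} (u : K) (h : X ^ M ∣ f) :
    X ^ M ∣ rescale u f := by
  rw [X_pow_dvd_iff] at h ⊢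
  intro m hm
  rw [coeff_rescale, h m hm, mul_zero]

theorem eq_of_X_pow_dvd_sub {f g : K⟦X⟧} (h : ∀ M, X ^ M ∣ f - g) : f = g := by
  ext n
  have := X_pow_dvd_iff.mp (h (n + 1)) n (by omega)
  rwa [map_sub, sub_eq_zero] at this

/-- The substitution `z ↦ ωz` permutes the factors of `thetaPoly` at cubes. -/
theorem thetaPoly_mul_comp_mul_comp {u : K} (hu : u ^ 2 + u + 1 = 0) (N : ℕ) :
    thetaPoly K N * (thetaPoly K N).comp (Polynomial.C (C u) * Polynomial.X) *
      (thetaPoly K N).comp (Polynomial.C (C (u ^ 2)) * Polynomial.X) =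
    Polynomial.expand K⟦X⟧ 3
      ((thetaPoly K N).map (expand 3 three_ne_zero : K⟦X⟧ →ₐ[K] K⟦X⟧).toRingHom) := by
  have h1 : (Polynomial.C (C u) : Polynomial K⟦X⟧) ^ 2 + Polynomial.C (C u) + 1 = 0 := by
    rw [← map_one Polynomial.C, ← map_one C, ← map_pow, ← map_pow, ← map_add, ← map_add,
      ← map_add, ← map_add, hu, map_zero, map_zero]
  simp only [thetaPoly, Polynomial.mul_comp, Polynomial.prod_comp, Polynomial.map_mul,
    Polynomial.map_prod, map_mul, map_prod]
  rw [show ∀ a b c d e f : Polynomial K⟦X⟧, a * b * (c * d) * (e * f) = (a * c * e) * (b * d * f)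
    from fun a b c d e f => by ring, ← prod_mul_distrib, ← prod_mul_distrib, ← prod_mul_distrib,
    ← prod_mul_distrib]
  congr 1
  · refine prod_congr rfl fun n _ => ?_
    simp only [Polynomial.add_comp, Polynomial.one_comp, Polynomial.mul_comp, Polynomial.C_comp,
      Polynomial.X_comp, Polynomial.pow_comp, map_pow, map_add, map_one, map_mul, Polynomial.map_add,
      Polynomial.map_one, Polynomial.map_mul, Polynomial.map_pow, Polynomial.map_C, Polynomial.map_X,
      Polynomial.expand_X, Polynomial.expand_C, AlgHom.toRingHom_eq_coe, RingHom.coe_coe, expand_X]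
    generalize (Polynomial.C (C u) : Polynomial K⟦X⟧) = w at *
    generalize (Polynomial.X : Polynomial K⟦X⟧) = z at *
    generalize (Polynomial.C (X : K⟦X⟧)) = q at *
    rw [pow_right_comm]
    generalize q ^ (n + 1) = s
    have h3 : w ^ 3 = 1 := by linear_combination (w - 1) * h1
    linear_combination (s * z + s ^ 2 * z ^ 2 * w) * h1 + s ^ 3 * z ^ 3 * h3
  · refine prod_congr rfl fun n _ => ?_
    simp only [Polynomial.add_comp, Polynomial.C_comp,
      Polynomial.X_comp, Polynomial.pow_comp, map_pow, map_add, Polynomial.map_add,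
      Polynomial.map_pow, Polynomial.map_C, Polynomial.map_X,
      Polynomial.expand_X, Polynomial.expand_C, AlgHom.toRingHom_eq_coe, RingHom.coe_coe, expand_X]
    generalize (Polynomial.C (C u) : Polynomial K⟦X⟧) = w at *
    generalize (Polynomial.X : Polynomial K⟦X⟧) = z at *
    generalize (Polynomial.C (X : K⟦X⟧)) = q at *
    rw [pow_right_comm]
    generalize q ^ n = s
    have h3 : w ^ 3 = 1 := by linear_combination (w - 1) * h1
    linear_combination (s ^ 2 * z + s * z ^ 2 * w) * h1 + z ^ 3 * h3

/-- `b(q) = E(q)³ / E(q³)` for the cubic theta function `b`. -/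
theorem expand_euler_mul_qfSeries [IsDomain K] {u : K} (hu : u ^ 2 + u + 1 = 0) :
    expand 3 three_ne_zero (euler K) * qfSeries u (u ^ 2) = euler K ^ 3 := by
  have h3 : u ^ 3 = 1 := by linear_combination (u - 1) * hu
  have h3' : (u ^ 2) ^ 3 = 1 := by rw [← pow_mul, mul_comm, pow_mul, h3, one_pow]
  refine eq_of_X_pow_dvd_sub fun M => ?_
  have h1 := X_pow_dvd_euler_cube_mul_coeff_sub h3 h3' (M := M) (N := 3 * (2 * M + 1))
    (by omega) (dvd_mul_right _ _)
  -- The product over `z`, `ωz`, `ω²z` is one triple product in `z³` and `q³`, whose central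
  -- coefficient tends to `1 / E(q³)`.
  rw [thetaPoly_mul_comp_mul_comp hu, mul_comm 3 (3 * (2 * M + 1)),
    Polynomial.coeff_expand_mul (by norm_num), Polynomial.coeff_map] at h1
  have h2 := X_pow_dvd_expand (X_pow_dvd_euler_mul_coeff_sub (K := K) (M := M)
    (N := 3 * (2 * M + 1)) (j := 3 * (2 * M + 1)) (by omega))
  rw [sub_self, map_sub, map_mul, show tri 0 = 0 from rfl, pow_zero, map_one] at h2
  obtain ⟨r, hr⟩ := h1
  obtain ⟨s, hs⟩ := h2
  refine ⟨euler K ^ 3 * s - expand 3 three_ne_zero (euler K) * r, ?_⟩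
  simp only [AlgHom.toRingHom_eq_coe, RingHom.coe_coe] at hr
  linear_combination euler K ^ 3 * hs - expand 3 three_ne_zero (euler K) * hr

/-- Factors with exponent `k` prime to 3 combine to `1 - q^(3k)`; those with `3 ∣ k` are fixed by `q
↦ ωq` and appear cubed. Induction adds exponents in blocks of three. -/
theorem qPoch_mul_rescale_mul_rescale {u : K} (hu : u ^ 2 + u + 1 = 0) (n : ℕ) :
    qPoch K (3 * n) * rescale u (qPoch K (3 * n)) * rescale (u ^ 2) (qPoch K (3 * n)) *
      expand 3 three_ne_zero (expand 3 three_ne_zero (qPoch K n)) =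
    expand 3 three_ne_zero (qPoch K (3 * n)) * expand 3 three_ne_zero (qPoch K n) ^ 3 := by
  induction n with
  | zero => simp [qPoch]
  | succ n ih =>
    have h1 : (C u : K⟦X⟧) ^ 2 + C u + 1 = 0 := by
      rw [← map_one C, ← map_pow, ← map_add, ← map_add, hu, map_zero]
    have h3 : (C u : K⟦X⟧) ^ 3 = 1 := by linear_combination (C u - 1) * h1
    have hcoprime : ∀ k, (C u : K⟦X⟧) ^ k = C u ∧ (C u : K⟦X⟧) ^ (2 * k) = C u ^ 2 ∨
        (C u : K⟦X⟧) ^ k = C u ^ 2 ∧ (C u : K⟦X⟧) ^ (2 * k) = C u →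
        (1 - X ^ k) * rescale u (1 - X ^ k) * rescale (u ^ 2) (1 - X ^ k) =
          expand 3 three_ne_zero (1 - (X : K⟦X⟧) ^ k) := by
      intro k hk
      simp only [map_sub, map_one, map_pow, rescale_X, expand_X, mul_pow]
      rw [← pow_mul (C u) 2 k, ← pow_mul X 3 k, mul_comm 3 k, pow_mul X k 3]
      generalize (X : K⟦X⟧) ^ k = x
      rcases hk with ⟨h, h'⟩ | ⟨h, h'⟩ <;> rw [h, h'] <;>
        linear_combination (-x + x ^ 2 * C u) * h1 - x ^ 3 * h3
    have hmul : ∀ v : K, v ^ 3 = 1 → rescale v (1 - X ^ (3 * (n + 1))) =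
        expand 3 three_ne_zero (1 - (X : K⟦X⟧) ^ (n + 1)) := by
      intro v hv
      simp only [map_sub, map_one, map_pow, rescale_X, expand_X, mul_pow]
      rw [← map_pow C, pow_mul v, hv, one_pow, map_one, one_mul, ← pow_mul]
    have h3' : ∀ k, (C u : K⟦X⟧) ^ (3 * k) = 1 := fun k => by rw [pow_mul, h3, one_pow]
    have hu3 : u ^ 3 = 1 := by linear_combination (u - 1) * hu
    have ha := hcoprime (3 * n + 1) (Or.inl ⟨by rw [pow_succ, h3', one_mul], by
      rw [show 2 * (3 * n + 1) = 3 * (2 * n) + 2 by ring, pow_add, h3', one_mul]⟩)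
    have hb := hcoprime (3 * n + 1 + 1) (Or.inr ⟨by rw [pow_succ, pow_succ, h3', one_mul, sq], by
      rw [show 2 * (3 * n + 1 + 1) = 3 * (2 * n + 1) + 1 by ring, pow_succ, h3', one_mul]⟩)
    have hc := hmul 1 (one_pow 3)
    rw [rescale_one, RingHom.id_apply] at hc
    have e : 3 * (n + 1) = 3 * n + 1 + 1 + 1 := by ring
    rw [e, qPoch_succ, qPoch_succ, qPoch_succ, qPoch_succ, ← e]
    simp only [map_mul, hmul u hu3, hmul (u ^ 2) (by rw [← pow_mul, mul_comm, pow_mul, hu3, one_pow])]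
    rw [← ha, ← hb, hc]
    linear_combination (expand 3 three_ne_zero (1 - (X : K⟦X⟧) ^ (n + 1))) ^ 3 *
      expand 3 three_ne_zero (expand 3 three_ne_zero (1 - (X : K⟦X⟧) ^ (n + 1))) *
      ((1 - X ^ (3 * n + 1)) * rescale u (1 - X ^ (3 * n + 1)) *
        rescale (u ^ 2) (1 - X ^ (3 * n + 1))) *
      ((1 - X ^ (3 * n + 1 + 1)) * rescale u (1 - X ^ (3 * n + 1 + 1)) *
        rescale (u ^ 2) (1 - X ^ (3 * n + 1 + 1))) * ih

/-- `E(q) E(ωq) E(ω²q) = E(q³)⁴ / E(q⁹)` -/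
theorem euler_mul_rescale_mul_rescale {u : K} (hu : u ^ 2 + u + 1 = 0) :
    euler K * rescale u (euler K) * rescale (u ^ 2) (euler K) *
      expand 3 three_ne_zero (expand 3 three_ne_zero (euler K)) =
    expand 3 three_ne_zero (euler K) ^ 4 := by
  refine eq_of_X_pow_dvd_sub fun M => ?_
  have h1 := X_pow_dvd_euler_sub_qPoch (K := K) (M := M) (n := M) (by omega)
  have h2 := X_pow_dvd_euler_sub_qPoch (K := K) (M := M) (n := 3 * M) (by omega)
  have h := qPoch_mul_rescale_mul_rescale hu M
  have e1 := X_pow_dvd_expand h1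
  have e2 := X_pow_dvd_expand h2
  have e3 := X_pow_dvd_expand e1
  have r1 := X_pow_dvd_rescale u h2
  have r2 := X_pow_dvd_rescale (u ^ 2) h2
  simp only [map_sub, ← Ideal.mem_span_singleton, ← Ideal.Quotient.eq] at *
  simp only [map_mul, map_pow]
  have h' := congrArg (Ideal.Quotient.mk (Ideal.span {(X : K⟦X⟧) ^ M})) h
  simp only [map_mul, map_pow] at h'
  rw [h2, r1, r2, e3, h', ← e1, ← e2]
  ring

end Cube

/-! ### Frobenius partitions as coefficients of a theta product. -/

section GeneratingFunction

/-- The colored integers with underlying integer less than `N`. -/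
def coloredBelow (k N : ℕ) : Finset (ColoredNat k) :=
  (range N ×ˢ (univ : Finset (Fin k))).map toLex.toEmbedding

theorem mem_coloredBelow {k N : ℕ} {a : ColoredNat k} : a ∈ coloredBelow k N ↔ a.value < N := by
  simp only [coloredBelow, Finset.mem_map, mem_product, mem_range, mem_univ, and_true,
    Equiv.coe_toEmbedding, ColoredNat.value]
  exact ⟨fun ⟨b, hb, h⟩ => h ▸ hb, fun h => ⟨ofLex a, h, rfl⟩⟩

theorem card_coloredBelow (k N : ℕ) : (coloredBelow k N).card = k * N := by
  simp [coloredBelow, mul_comm]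

theorem thetaPoly_pow_eq_prod {K : Type*} [CommRing K] (k N : ℕ) :
    thetaPoly K N ^ k =
      (∏ a ∈ coloredBelow k N, (1 + Polynomial.C (X ^ (a.value + 1)) * Polynomial.X)) *
        ∏ a ∈ coloredBelow k N, (Polynomial.C (X ^ a.value) + Polynomial.X) := by
  simp only [coloredBelow, prod_map, prod_product, Equiv.coe_toEmbedding, ColoredNat.value,
    ofLex_toLex, prod_const, card_univ, Fintype.card_fin, thetaPoly, mul_pow, prod_pow,
    add_comm Polynomial.X]

/-- Pairs of sets of colored integers below `N` that are the rows of an array of size `n`. -/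
def rowPairs (k N n : ℕ) : Finset (Finset (ColoredNat k) × Finset (ColoredNat k)) :=
  ((coloredBelow k N).powerset ×ˢ (coloredBelow k N).powerset).filter fun p =>
    p.1.card = p.2.card ∧
      n = p.1.card + ((∑ a ∈ p.1, a.value) + ∑ a ∈ p.2, a.value)

/-- Take the `z`-terms of the first product on `S` and the constant terms of the second on `T`. The
degree in `z` is `|S| + kN - |T|`, so `z^(kN)` forces equal row lengths, and the exponent of `q` is
the size of the array. -/
theorem coeff_coeff_thetaPoly_pow {K : Type*} [CommRing K] (k N n : ℕ) :
    coeff n ((thetaPoly K N ^ k).coeff (k * N)) = ((rowPairs k N n).card : K) := by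
  have h : ∀ S ∈ (coloredBelow k N).powerset, ∀ T ∈ (coloredBelow k N).powerset,
      coeff n (Polynomial.coeff ((∏ a ∈ S, Polynomial.C ((X : K⟦X⟧) ^ (a.value + 1)) * Polynomial.X) *
        ((∏ a ∈ T, Polynomial.C (X ^ a.value)) * ∏ a ∈ coloredBelow k N \ T, Polynomial.X))
        (k * N)) =
      if S.card = T.card ∧ n = S.card + ((∑ a ∈ S, a.value) + ∑ a ∈ T, a.value) then 1 else 0 := by
    intro S hS T hT
    rw [mem_powerset] at hS hT
    have hc := card_sdiff_add_card_eq_card hT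
    have hle := card_le_card hS
    rw [card_coloredBelow] at hc hle
    rw [prod_mul_distrib, prod_const, prod_const, ← map_prod, ← map_prod, prod_pow_eq_pow_sum,
      prod_pow_eq_pow_sum, sum_add_distrib, sum_const, smul_eq_mul, mul_one,
      mul_mul_mul_comm, ← map_mul, ← pow_add, ← pow_add, Polynomial.coeff_C_mul_X_pow]
    by_cases hST : S.card = T.card
    · rw [if_pos (by omega), coeff_X_pow]
      refine if_congr ?_ rfl rfl
      omega
    · rw [if_neg (by omega), if_neg (by tauto), map_zero]
  rw [thetaPoly_pow_eq_prod, prod_one_add, prod_add, sum_mul_sum, Polynomial.finsetSum_coeff,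
    map_sum]
  simp_rw [Polynomial.finsetSum_coeff, map_sum]
  rw [sum_congr rfl fun S hS => sum_congr rfl fun T hT => h S hS T hT, ← sum_product']
  rw [rowPairs, card_filter]
  push_cast
  rfl

theorem toFinset_injOn {k : ℕ} {l l' : List (ColoredNat k)} (h : l.Pairwise (· > ·))
    (h' : l'.Pairwise (· > ·)) (e : l.toFinset = l'.toFinset) : l = l' := by
  have hp : l.Perm l' := by
    rw [List.perm_ext_iff_of_nodup (h.imp ne_of_gt) (h'.imp ne_of_gt)]
    intro a
    rw [← List.mem_toFinset, e, List.mem_toFinset]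
  exact hp.eq_of_pairwise (fun a b _ _ h1 h2 => absurd h1 (lt_asymm h2)) h h'

theorem sum_toFinset_value {k : ℕ} {l : List (ColoredNat k)} (h : l.Pairwise (· > ·)) :
    ∑ a ∈ l.toFinset, a.value = (l.map ColoredNat.value).sum :=
  List.sum_toFinset _ (h.imp ne_of_gt)

theorem pairwise_sort_gt {k : ℕ} (S : Finset (ColoredNat k)) :
    (S.sort (· ≥ ·)).Pairwise (· > ·) :=
  ((S.pairwise_sort (· ≥ ·)).and (S.sort_nodup (· ≥ ·))).imp
    fun h => lt_of_le_of_ne h.1 (Ne.symm h.2)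

/-- Entries of an array of size `n` are at most `n < N`, so the truncation loses nothing; sorting
recovers the rows from their sets. -/
theorem cphi_eq_card_rowPairs {k N n : ℕ} (h : n < N) : cphi k n = (rowPairs k N n).card := by
  rw [cphi, ← Nat.card_eq_finsetCard]
  have hval : ∀ {S : Finset (ColoredNat k)}, ∑ a ∈ S, a.value ≤ n → S ∈ (coloredBelow k N).powerset :=
    fun {S} hS => mem_powerset.mpr fun a ha => mem_coloredBelow.mpr
      (((single_le_sum (fun _ _ => Nat.zero_le _) ha).trans hS).trans_lt h)
  refine Nat.card_eq_of_bijective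
    (fun π => ⟨(π.1.top.toFinset, π.1.bottom.toFinset), ?_⟩) ⟨?_, ?_⟩
  · obtain ⟨⟨t, b, hl, ht, hb⟩, rfl⟩ := π
    have hsize : (∑ a ∈ t.toFinset, a.value) + ∑ a ∈ b.toFinset, a.value ≤
        ColoredFrobeniusPartition.size ⟨t, b, hl, ht, hb⟩ := by
      rw [sum_toFinset_value ht, sum_toFinset_value hb]
      exact Nat.le_add_left _ _
    rw [rowPairs, mem_filter, mem_product]
    refine ⟨⟨hval (by simp only; omega), hval (by simp only; omega)⟩, ?_, ?_⟩
    · rw [List.toFinset_card_of_nodup (ht.imp ne_of_gt), List.toFinset_card_of_nodup (hb.imp ne_of_gt),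
        hl]
    · rw [List.toFinset_card_of_nodup (ht.imp ne_of_gt), sum_toFinset_value ht,
        sum_toFinset_value hb]
      rfl
  · rintro ⟨⟨t, b, hl, ht, hb⟩, h1⟩ ⟨⟨t', b', hl', ht', hb'⟩, h2⟩ e
    simp only [Subtype.mk.injEq, Prod.mk.injEq] at e
    obtain rfl := toFinset_injOn ht ht' e.1
    obtain rfl := toFinset_injOn hb hb' e.2
    rfl
  · rintro ⟨⟨S, T⟩, hST⟩
    rw [rowPairs, mem_filter] at hST
    obtain ⟨-, hc, hn⟩ := hST
    refine ⟨⟨⟨S.sort (· ≥ ·), T.sort (· ≥ ·), by simpa using hc, pairwise_sort_gt S,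
      pairwise_sort_gt T⟩, ?_⟩, by simp⟩
    have hsum : ∀ S : Finset (ColoredNat k),
        ((S.sort (· ≥ ·)).map ColoredNat.value).sum = ∑ a ∈ S, a.value := fun S => by
      rw [← sum_toFinset_value (pairwise_sort_gt S), sort_toFinset]
    simp only [ColoredFrobeniusPartition.size]
    rw [length_sort, hsum, hsum]
    exact hn.symm

/-- The generating function of three-colored Frobenius partitions is `a(q) / ∏ (1 - qⁱ)³`. -/
theorem euler_cube_mul_mk_cphi :
    euler ℤ ^ 3 * PowerSeries.mk (fun n => (cphi 3 n : ℤ)) = qfSeries 1 1 := by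
  refine eq_of_X_pow_dvd_sub fun M => ?_
  have h1 := X_pow_dvd_euler_cube_mul_coeff_sub (one_pow 3 : (1 : ℤ) ^ 3 = 1) (one_pow 3) (M := M)
    (N := 3 * (2 * M + 1)) (by omega) (dvd_mul_right _ _)
  simp only [map_one, one_mul, Polynomial.comp_X, ← pow_three'] at h1
  have h2 : (X : ℤ⟦X⟧) ^ M ∣ PowerSeries.mk (fun n => (cphi 3 n : ℤ)) -
      (thetaPoly ℤ (3 * (2 * M + 1)) ^ 3).coeff (3 * (3 * (2 * M + 1))) := by
    rw [X_pow_dvd_iff]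
    intro m hm
    rw [map_sub, coeff_mk, coeff_coeff_thetaPoly_pow,
      cphi_eq_card_rowPairs (show m < 3 * (2 * M + 1) by omega), sub_self]
  have h3 := dvd_add (dvd_mul_of_dvd_right h2 (euler ℤ ^ 3)) h1
  convert h3 using 1
  ring

end GeneratingFunction

/-! ### Jacobi's identity for the cube of the Euler product. -/

section Jacobi

/-- The coefficients of `∑ (-1)ᵏ (2k + 1) q ^ (k (k + 1) / 2)`. -/
def jacobiCoeff (n : ℕ) : ℤ :=
  ∑ k ∈ range (n + 1), if k * (k + 1) = 2 * n then (-1) ^ k * (2 * k + 1) else 0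

theorem jacobiCoeff_eq {n k : ℕ} (h : k * (k + 1) = 2 * n) :
    jacobiCoeff n = (-1) ^ k * (2 * k + 1) := by
  rw [jacobiCoeff, sum_eq_single k, if_pos h]
  · intro l _ hl
    refine if_neg fun hl' => hl ?_
    rw [← h] at hl'
    nlinarith
  · intro hk
    rw [mem_range] at hk
    nlinarith

theorem jacobiCoeff_eq_zero {n : ℕ} (h : ∀ k, k * (k + 1) ≠ 2 * n) : jacobiCoeff n = 0 :=
  sum_eq_zero fun k _ => if_neg (h k)

/-- The factor `z + q⁰` vanishes at `z = -1`, so the derivative there is the product of the other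
factors. Subtracting `N + 1` times the vanishing value recentres the weights; odd `N` fixes the
sign. -/
theorem qPoch_mul_qPoch_eq_sum (N : ℕ) (hN : Odd N) :
    qPoch ℤ (N + 1) * qPoch ℤ N = ∑ j ∈ range (2 * (N + 1) + 1),
      (thetaPoly ℤ (N + 1)).coeff j * ((j - (N + 1)) * (-1) ^ j) := by
  have hdeg := Nat.lt_succ_of_le (natDegree_thetaPoly_le (K := ℤ) (N + 1))
  have h0 : (thetaPoly ℤ (N + 1)) =
      ((∏ n ∈ range (N + 1), (1 + Polynomial.C (X ^ (n + 1)) * Polynomial.X)) *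
        ∏ n ∈ range N, (Polynomial.X + Polynomial.C (X ^ (n + 1)))) * (Polynomial.X + 1) := by
    rw [thetaPoly, prod_range_succ' (fun n => (Polynomial.X + Polynomial.C ((X : ℤ⟦X⟧) ^ n)))]
    simp [mul_assoc]
  have h1 : (thetaPoly ℤ (N + 1)).eval (-1) = 0 := by
    rw [h0, Polynomial.eval_mul]
    simp
  have h2 : (Polynomial.derivative (thetaPoly ℤ (N + 1))).eval (-1) =
      -(qPoch ℤ (N + 1) * qPoch ℤ N) := by
    have h3 : ∏ n ∈ range N, (-1 + (X : ℤ⟦X⟧) ^ (n + 1)) = - qPoch ℤ N := by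
      have h4 : ∀ n, -1 + (X : ℤ⟦X⟧) ^ (n + 1) = -(1 - X ^ (n + 1)) := fun n => by ring
      rw [prod_congr rfl fun n _ => h4 n, prod_neg, card_range, hN.neg_one_pow, neg_one_mul, qPoch]
    rw [h0, Polynomial.derivative_mul, Polynomial.eval_add, Polynomial.eval_mul,
      Polynomial.eval_mul]
    simp only [Polynomial.derivative_add, Polynomial.derivative_X, Polynomial.derivative_one,
      Polynomial.eval_add, Polynomial.eval_X, Polynomial.eval_one, neg_add_cancel, mul_zero,
      zero_add, add_zero, mul_one, Polynomial.eval_mul, Polynomial.eval_prod, Polynomial.eval_C, h3]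
    simp only [← sub_eq_add_neg, mul_neg, mul_one, qPoch]
  rw [(thetaPoly ℤ (N + 1)).as_sum_range' _ hdeg, Polynomial.eval_finsetSum] at h1
  rw [(thetaPoly ℤ (N + 1)).as_sum_range' _ hdeg, Polynomial.derivative_sum,
    Polynomial.eval_finsetSum] at h2
  have h3 : ∑ j ∈ range (2 * (N + 1) + 1),
      (thetaPoly ℤ (N + 1)).coeff j * ((j - (N + 1)) * (-1) ^ j) =
      -(∑ j ∈ range (2 * (N + 1)).succ, (Polynomial.derivative
        (Polynomial.monomial j ((thetaPoly ℤ (N + 1)).coeff j))).eval (-1)) -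
      (N + 1) * ∑ j ∈ range (2 * (N + 1)).succ,
        (Polynomial.monomial j ((thetaPoly ℤ (N + 1)).coeff j)).eval (-1) := by
    rw [mul_sum, ← sum_neg_distrib, ← sum_sub_distrib]
    refine sum_congr rfl fun j _ => ?_
    rw [Polynomial.derivative_monomial, Polynomial.eval_monomial, Polynomial.eval_monomial]
    rcases j with _ | j
    · push_cast; ring
    · rw [Nat.add_sub_cancel]; push_cast; ring
  rw [h3, h1, h2, neg_neg, mul_zero, sub_zero]

/-- Jacobi's identity `∏ (1 - qⁱ)³ = ∑ (-1)ᵏ (2k + 1) q ^ (k (k + 1) / 2)`. -/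
theorem coeff_euler_cube (m : ℕ) : coeff m (euler ℤ ^ 3) = jacobiCoeff m := by
  obtain ⟨N, hN⟩ : ∃ N, N = 2 * (m + 1) + 1 := ⟨_, rfl⟩
  have h := qPoch_mul_qPoch_eq_sum N (by rw [hN]; exact ⟨m + 1, rfl⟩)
  have h1 := X_pow_dvd_euler_sub_qPoch (K := ℤ) (M := m + 1) (n := N) (by omega)
  have h2 := X_pow_dvd_euler_sub_qPoch (K := ℤ) (M := m + 1) (n := N + 1) (by omega)
  have h3 : ∀ j, (X : ℤ⟦X⟧) ^ (m + 1) ∣ euler ℤ * (thetaPoly ℤ (N + 1)).coeff j -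
      X ^ tri (j - (N + 1 : ℕ)) :=
    fun j => X_pow_dvd_euler_mul_coeff_sub (K := ℤ) (M := m + 1) (N := N + 1) (by omega)
  have h4 : (X : ℤ⟦X⟧) ^ (m + 1) ∣ euler ℤ ^ 3 - ∑ j ∈ range (2 * (N + 1) + 1),
      X ^ tri (j - (N + 1 : ℕ)) * C (((j : ℤ) - (N + 1)) * (-1) ^ j) := by
    simp only [← Ideal.mem_span_singleton, ← Ideal.Quotient.eq] at h1 h2 h3 ⊢
    rw [map_sum]
    simp_rw [map_mul _ (X ^ _), ← h3, ← map_mul]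
    rw [← map_sum]
    simp_rw [mul_assoc (euler ℤ)]
    have h6 : ∑ j ∈ range (2 * (N + 1) + 1),
        (thetaPoly ℤ (N + 1)).coeff j * C (((j : ℤ) - (N + 1)) * (-1) ^ j) =
        qPoch ℤ (N + 1) * qPoch ℤ N := by
      rw [h]
      exact sum_congr rfl fun j _ => by simp
    rw [← mul_sum, h6, map_mul, map_mul, ← h1, ← h2, map_pow]
    ring
  have h5 := X_pow_dvd_iff.mp h4 m (by omega)
  rw [map_sub, sub_eq_zero, map_sum] at h5
  simp_rw [coeff_mul_C, coeff_X_pow] at h5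
  -- The indices `k` and `-1 - k` share a triangular number, and their weights `k` and `k + 1` add
  -- to `2k + 1`. The last index is unpaired, but its exponent exceeds `m`.
  rw [h5, show 2 * (N + 1) + 1 = (N + 1) + (N + 1 + 1) by ring, sum_range_add,
    ← sum_range_reflect, sum_range_succ _ (N + 1), ← add_assoc, ← sum_add_distrib]
  have htri : ∀ k : ℕ, m = tri k ↔ k * (k + 1) = 2 * m := fun k => by
    have := two_mul_tri k
    zify
    omega
  have hsymm : ∀ k : ℕ, tri (-1 - k) = tri k := fun k => by
    have h1 := two_mul_tri k
    have h2 := two_mul_tri (-1 - k)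
    zify
    linarith
  have hlast : ¬ m = tri ((N + 1 : ℕ) : ℤ) := by
    rw [htri]
    nlinarith
  rw [show (((N + 1 + (N + 1) : ℕ) : ℤ) - (N + 1 : ℕ)) = (N + 1 : ℕ) by push_cast; ring, if_neg hlast,
    zero_mul, add_zero, jacobiCoeff]
  have hsub : range (m + 1) ⊆ range (N + 1) := range_subset_range.mpr (by omega)
  rw [sum_subset hsub fun k _ hk => if_neg fun hk' => hk (mem_range.mpr (by nlinarith))]
  refine sum_congr rfl fun k hk => ?_
  rw [mem_range] at hk
  have e1 : ((N + 1 - 1 - k : ℕ) : ℤ) = N - k := by omega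
  have e2 : (-1 : ℤ) ^ (N + 1 - 1 - k) = -(-1) ^ k := by
    have : (-1 : ℤ) ^ (N + 1 - 1 - k) * (-1) ^ k = -1 := by
      rw [← pow_add, show N + 1 - 1 - k + k = N by omega, hN]
      exact Odd.neg_one_pow ⟨m + 1, rfl⟩
    rcases neg_one_pow_eq_or ℤ k with h | h <;> rw [h] at this ⊢ <;> linarith
  have e3 : (-1 : ℤ) ^ (N + 1 + k) = (-1) ^ k := by
    rw [pow_add, show N + 1 = 2 * (m + 2) by omega, pow_mul]
    simp
  rw [e1, e2, e3, show ((N : ℤ) - k - (N + 1 : ℕ)) = -1 - k by push_cast; ring, hsymm,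
    show (((N + 1 + k : ℕ) : ℤ) - (N + 1 : ℕ)) = k by push_cast; ring, if_congr (htri k) rfl rfl]
  split_ifs
  · push_cast; ring
  · ring

/-- The terms of `∏ (1 - qⁱ)³` with exponents `3n + 1` sum to `-3q ∏ (1 - q⁹ⁱ)³`. -/
theorem coeff_euler_cube_three_mul_add_one (n : ℕ) :
    coeff (3 * n + 1) (euler ℤ ^ 3) =
      coeff n (-3 * expand 3 three_ne_zero (euler ℤ ^ 3)) := by
  rw [show (-3 : ℤ⟦X⟧) = C (-3) by simp, coeff_C_mul, coeff_expand, coeff_euler_cube,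
    coeff_euler_cube]
  have hmod : ∀ k : ℕ, k * (k + 1) = 2 * (3 * n + 1) → k % 3 = 1 := by
    intro k hk
    have h1 : k * (k + 1) % 3 = 2 := by omega
    have h2 : k % 3 = 0 ∨ k % 3 = 1 ∨ k % 3 = 2 := by omega
    rcases h2 with h | h | h
    · simp [Nat.mul_mod, h] at h1
    · exact h
    · simp [Nat.mul_mod, Nat.add_mod, h] at h1
  by_cases h : ∃ l, 3 * (l * (l + 1)) = 2 * n
  · obtain ⟨l, hl⟩ := h
    have h3 : 3 ∣ n := by omega
    -- Triangular numbers congruent to 1 mod 3 come from `k = 3l + 1`, where `k(k+1)/2 = 9·l(l+1)/2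
    -- + 1` and `2k + 1 = 3(2l + 1)`.
    rw [if_pos h3, jacobiCoeff_eq (k := 3 * l + 1) (by linarith), jacobiCoeff_eq (k := l) (by omega),
      pow_succ, pow_mul]
    push_cast
    norm_num
    ring
  · have h1 : jacobiCoeff (3 * n + 1) = 0 := by
      refine jacobiCoeff_eq_zero fun k hk => h ⟨k / 3, ?_⟩
      obtain ⟨l, rfl⟩ : ∃ l, k = 3 * l + 1 := ⟨k / 3, by have := hmod k hk; omega⟩
      rw [show (3 * l + 1) / 3 = l by omega]
      linarith
    rw [h1]
    split_ifs with h3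
    · rw [jacobiCoeff_eq_zero fun k hk => h ⟨k, by omega⟩, mul_zero]
    · rw [mul_zero]

end Jacobi

/-! ### Extraction of exponents in a residue class mod 3. -/

section Dissection

variable {K : Type*} [CommRing K]

/-- The series `∑ f (3n + r) qⁿ` -/
noncomputable def dissect (r : ℕ) : K⟦X⟧ →+ K⟦X⟧ where
  toFun f := PowerSeries.mk fun n => coeff (3 * n + r) f
  map_zero' := by ext; simp
  map_add' f g := by ext; simp

theorem coeff_dissect (r n : ℕ) (f : K⟦X⟧) : coeff n (dissect r f) = coeff (3 * n + r) f :=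
  coeff_mk n fun n => coeff (3 * n + r) f

theorem coeff_expand_mul_three_mul_add (f g : K⟦X⟧) (r n : ℕ) (hr : r < 3) :
    coeff (3 * n + r) (expand 3 three_ne_zero f * g) = coeff n (f * dissect r g) := by
  rw [coeff_mul, coeff_mul]
  simp_rw [coeff_expand, ite_mul, zero_mul]
  rw [← sum_filter]
  refine sum_bij' (fun p _ => (p.1 / 3, p.2 / 3)) (fun p _ => (3 * p.1, 3 * p.2 + r)) ?_ ?_ ?_ ?_ ?_
  · rintro ⟨i, j⟩ h
    simp only [mem_filter, HasAntidiagonal.mem_antidiagonal] at h ⊢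
    omega
  · rintro ⟨i, j⟩ h
    simp only [mem_filter, HasAntidiagonal.mem_antidiagonal] at h ⊢
    omega
  · rintro ⟨i, j⟩ h
    simp only [mem_filter, HasAntidiagonal.mem_antidiagonal, Prod.mk.injEq] at h ⊢
    omega
  · rintro ⟨i, j⟩ h
    simp only [HasAntidiagonal.mem_antidiagonal, Prod.mk.injEq] at h ⊢
    omega
  · rintro ⟨i, j⟩ h
    simp only [mem_filter, HasAntidiagonal.mem_antidiagonal] at h
    rw [coeff_dissect, show 3 * (j / 3) + r = j by omega]

theorem dissect_expand_mul {r : ℕ} (hr : r < 3) (f g : K⟦X⟧) :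
    dissect r (expand 3 three_ne_zero f * g) = f * dissect r g := by
  ext n
  rw [coeff_dissect, coeff_expand_mul_three_mul_add f g r n hr]

theorem dissect_X_pow {r j : ℕ} (hr : r < 3) :
    dissect r ((X : K⟦X⟧) ^ j) = if j % 3 = r then X ^ (j / 3) else 0 := by
  ext n
  rw [coeff_dissect, coeff_X_pow]
  split_ifs with h1 h2 h2
  · rw [coeff_X_pow, if_pos (by omega)]
  · omega
  · rw [coeff_X_pow, if_neg (by omega)]
  · simp

theorem dissect_natCast_mul (r m : ℕ) (f : K⟦X⟧) :
    dissect r ((m : K⟦X⟧) * f) = (m : K⟦X⟧) * dissect r f := by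
  rw [← nsmul_eq_mul, map_nsmul, nsmul_eq_mul]

theorem dissect_ofNat_mul (r m : ℕ) [m.AtLeastTwo] (f : K⟦X⟧) :
    dissect r ((ofNat(m) : K⟦X⟧) * f) = (ofNat(m) : K⟦X⟧) * dissect r f :=
  dissect_natCast_mul r m f

end Dissection

/-! ### Three-dissection of `a(q)` and of `E(q)³`. -/

section CubicTheta

/-- The cubic theta function `a(q) = ∑ q ^ (x² + xy + y²)`. -/
noncomputable def cubicA : ℤ⟦X⟧ := PowerSeries.mk fun n => ((qfSet n).card : ℤ)

theorem qfSeries_one : qfSeries (1 : ℤ) 1 = cubicA := by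
  ext n
  simp [qfSeries, cubicA]

theorem emod_three_of_mem_qfSet {n : ℕ} {p : ℤ × ℤ} (hp : p ∈ qfSet n) :
    (n : ℤ) % 3 = ((p.1 - p.2) ^ 2) % 3 := by
  rw [mem_qfSet] at hp
  rw [← hp, show p.1 ^ 2 + p.1 * p.2 + p.2 ^ 2 = (p.1 - p.2) ^ 2 + 3 * (p.1 * p.2) by ring]
  omega

theorem sub_emod_three_of_mem_qfSet {n : ℕ} {p : ℤ × ℤ} (hp : p ∈ qfSet n) :
    (n % 3 = 0 ∧ (p.1 - p.2) % 3 = 0) ∨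
      (n % 3 = 1 ∧ ((p.1 - p.2) % 3 = 1 ∨ (p.1 - p.2) % 3 = 2)) := by
  have h := emod_three_of_mem_qfSet hp
  have h2 : (p.1 - p.2) % 3 = 0 ∨ (p.1 - p.2) % 3 = 1 ∨ (p.1 - p.2) % 3 = 2 := by omega
  rcases h2 with h2 | h2 | h2 <;> rw [sq, Int.mul_emod, h2] at h <;> norm_num at h <;> omega

theorem qfSet_three_mul_add_two (n : ℕ) : qfSet (3 * n + 2) = ∅ := by
  rw [eq_empty_iff_forall_notMem]
  intro p hp
  have := sub_emod_three_of_mem_qfSet hp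
  omega

/-- The map `(x, y) ↦ (x - y, x + 2y)` multiplies the form by 3, like an Eisenstein integer of norm
3; `x ≡ y` mod 3 makes it invertible here. -/
theorem card_qfSet_three_mul (n : ℕ) : (qfSet (3 * n)).card = (qfSet n).card := by
  refine card_bij' (fun p _ => ((2 * p.1 + p.2) / 3, (p.2 - p.1) / 3))
    (fun p _ => (p.1 - p.2, p.1 + 2 * p.2)) ?_ ?_ ?_ ?_
  · rintro ⟨x, y⟩ h
    have h1 := sub_emod_three_of_mem_qfSet h
    simp only at h1
    obtain ⟨k, rfl⟩ : ∃ k, x = y + 3 * k := ⟨(x - y) / 3, by omega⟩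
    rw [mem_qfSet] at h ⊢
    simp only at h ⊢
    rw [show (2 * (y + 3 * k) + y) / 3 = y + 2 * k by omega, show (y - (y + 3 * k)) / 3 = -k by omega]
    push_cast at h
    linarith
  · rintro ⟨x, y⟩ h
    rw [mem_qfSet] at h ⊢
    push_cast
    simp only at h ⊢
    linarith
  · rintro ⟨x, y⟩ h
    have h1 := sub_emod_three_of_mem_qfSet h
    simp only [Prod.mk.injEq] at h1 ⊢
    omega
  · rintro ⟨x, y⟩ h
    simp only [Prod.mk.injEq]
    omega

theorem cubicA_eq_expand_add : cubicA = expand 3 three_ne_zero cubicA +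
    X * expand 3 three_ne_zero (dissect 1 cubicA) := by
  ext n
  obtain ⟨m, rfl | rfl | rfl⟩ : ∃ m, n = 3 * m ∨ n = 3 * m + 1 ∨ n = 3 * m + 2 :=
    ⟨n / 3, by omega⟩
  · rw [map_add, coeff_expand_mul]
    rcases m with _ | m
    · simp [cubicA]
    · rw [show 3 * (m + 1) = 3 * m + 2 + 1 by ring, coeff_succ_X_mul, coeff_expand,
        if_neg (by omega), add_zero, show 3 * m + 2 + 1 = 3 * (m + 1) by ring, cubicA, coeff_mk,
        coeff_mk, card_qfSet_three_mul]
  · rw [map_add, coeff_expand, if_neg (by omega), zero_add, coeff_succ_X_mul, coeff_expand_mul,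
      coeff_dissect]
  · rw [map_add, coeff_expand, if_neg (by omega), zero_add, coeff_succ_X_mul, coeff_expand,
      if_neg (by omega), cubicA, coeff_mk, qfSet_three_mul_add_two, card_empty, Nat.cast_zero]

/-- The weight is `ω^(x - y)`. It is 1 when `3 ∣ n`; when `n ≡ 1`, swapping `x` and `y` pairs `ω`
with `ω²`, of sum `-1`. Doubling avoids halves. -/
theorem two_mul_qfSeries {K : Type*} [CommRing K] {u : K} (hu : u ^ 2 + u + 1 = 0) :
    2 * qfSeries u (u ^ 2) = PowerSeries.map (Int.castRingHom K)
      (2 * expand 3 three_ne_zero cubicA - X * expand 3 three_ne_zero (dissect 1 cubicA)) := by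
  have h3 : u ^ 3 = 1 := by linear_combination (u - 1) * hu
  have hpow : ∀ p : ℤ × ℤ, u ^ (p.1 % 3).toNat * (u ^ 2) ^ (p.2 % 3).toNat =
      u ^ ((p.1 - p.2) % 3).toNat := by
    intro p
    rw [← pow_mul, ← pow_add, pow_eq_pow_mod _ h3]
    congr 1
    omega
  ext n
  rw [two_mul, map_add, qfSeries, coeff_mk]
  simp_rw [hpow]
  rw [coeff_map, map_sub, two_mul, map_add]
  obtain ⟨m, rfl | rfl | rfl⟩ : ∃ m, n = 3 * m ∨ n = 3 * m + 1 ∨ n = 3 * m + 2 :=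
    ⟨n / 3, by omega⟩
  · have h1 : ∑ p ∈ qfSet (3 * m), u ^ ((p.1 - p.2) % 3).toNat = (qfSet m).card := by
      rw [sum_congr rfl fun p hp => show u ^ ((p.1 - p.2) % 3).toNat = 1 by
        have := sub_emod_three_of_mem_qfSet hp
        rw [show (p.1 - p.2) % 3 = 0 by omega, Int.toNat_zero, pow_zero]]
      rw [sum_const, nsmul_one, card_qfSet_three_mul]
    have h2 : coeff (3 * m) ((X : ℤ⟦X⟧) * expand 3 three_ne_zero (dissect 1 cubicA)) = 0 := by
      rcases m with _ | m
      · simp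
      · rw [show 3 * (m + 1) = 3 * m + 2 + 1 by ring, coeff_succ_X_mul, coeff_expand,
          if_neg (by omega)]
    rw [h1, h2, coeff_expand_mul, cubicA, coeff_mk]
    simp
  · have h1 : ∑ p ∈ qfSet (3 * m + 1), u ^ ((p.1 - p.2) % 3).toNat =
        ∑ p ∈ qfSet (3 * m + 1), u ^ ((p.2 - p.1) % 3).toNat := by
      refine sum_bij' (fun p _ => p.swap) (fun p _ => p.swap) ?_ ?_ ?_ ?_ ?_
      · intro p hp
        rw [mem_qfSet] at hp ⊢
        simp only [Prod.fst_swap, Prod.snd_swap]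
        linarith
      · intro p hp
        rw [mem_qfSet] at hp ⊢
        simp only [Prod.fst_swap, Prod.snd_swap]
        linarith
      all_goals simp
    nth_rewrite 1 [h1]
    rw [← sum_add_distrib, sum_congr rfl fun p hp =>
      show u ^ ((p.2 - p.1) % 3).toNat + u ^ ((p.1 - p.2) % 3).toNat = -1 by
        have := sub_emod_three_of_mem_qfSet hp
        have h4 : ((p.2 - p.1) % 3).toNat = 1 ∧ ((p.1 - p.2) % 3).toNat = 2 ∨
          ((p.2 - p.1) % 3).toNat = 2 ∧ ((p.1 - p.2) % 3).toNat = 1 := by omega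
        rcases h4 with ⟨h, h'⟩ | ⟨h, h'⟩ <;> rw [h, h'] <;> linear_combination hu]
    rw [coeff_succ_X_mul, coeff_expand_mul, coeff_dissect, coeff_expand, if_neg (by omega), cubicA,
      coeff_mk, sum_const]
    simp
  · rw [qfSet_three_mul_add_two, coeff_succ_X_mul, coeff_expand, if_neg (by omega), coeff_expand,
      if_neg (by omega)]
    simp

theorem map_qPoch {K L : Type*} [CommRing K] [CommRing L] (f : K →+* L) (n : ℕ) :
    PowerSeries.map f (qPoch K n) = qPoch L n := by
  simp [qPoch, map_prod]

theorem map_euler {K L : Type*} [CommRing K] [CommRing L] (f : K →+* L) :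
    PowerSeries.map f (euler K) = euler L := by
  ext n
  rw [coeff_map, euler, euler, coeff_mk, coeff_mk, ← coeff_map, map_qPoch]

theorem exists_omega : ∃ u : ℂ, u ^ 2 + u + 1 = 0 := by
  have h := Complex.isPrimitiveRoot_exp 3 (by norm_num)
  have h1 := h.geom_sum_eq_zero (by norm_num)
  simp only [sum_range_succ, range_zero, sum_empty, zero_add, pow_zero, pow_one] at h1
  exact ⟨_, by linear_combination h1⟩

theorem map_intCast_injective :
    Function.Injective (PowerSeries.map (Int.castRingHom ℂ)) :=
  PowerSeries.map_injective _ Int.cast_injective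

theorem two_mul_euler_cube : 2 * euler ℤ ^ 3 = expand 3 three_ne_zero (euler ℤ) *
    (2 * expand 3 three_ne_zero cubicA - X * expand 3 three_ne_zero (dissect 1 cubicA)) := by
  obtain ⟨u, hu⟩ := exists_omega
  apply map_intCast_injective
  rw [map_mul _ (expand 3 three_ne_zero _), ← two_mul_qfSeries hu, map_expand, map_euler, map_mul,
    map_pow, map_euler, ← expand_euler_mul_qfSeries hu, map_ofNat]
  ring

end CubicTheta

/-! ### Cubic theta identities as eta quotients. -/

section CubicIdentities

/-- The inverse of the Euler product, i.e. the generating function of partitions. -/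
noncomputable def eulerInv : ℤ⟦X⟧ := invOfUnit (euler ℤ) 1

theorem euler_mul_eulerInv : euler ℤ * eulerInv = 1 :=
  mul_invOfUnit _ _ constantCoeff_euler

theorem euler_pow_mul_eulerInv_pow {p q r : ℕ} (h : p + q = r) :
    euler ℤ ^ p * eulerInv ^ r = eulerInv ^ q := by
  rw [← h, pow_add, ← mul_assoc, ← mul_pow, euler_mul_eulerInv, one_pow, one_mul]

/-- One third of the cubic theta function `c(q)`, without its factor `q ^ (1 / 3)`, as the
eta quotient `∏ (1 - q³ⁱ)³ / ∏ (1 - qⁱ)`. -/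
noncomputable def cubicC : ℤ⟦X⟧ := expand 3 three_ne_zero (euler ℤ) ^ 3 * eulerInv

/-- Compare the exponents `3n + 1` on the two sides of `two_mul_euler_cube`, the left one being
known from Jacobi's identity. -/
theorem dissect_one_cubicA : dissect 1 cubicA = 6 * cubicC := by
  have h := congrArg (dissect 1) two_mul_euler_cube
  have h1 : dissect 1 (euler ℤ ^ 3) = -3 * expand 3 three_ne_zero (euler ℤ ^ 3) := by
    ext n
    rw [coeff_dissect, coeff_euler_cube_three_mul_add_one]
  have h2 : 2 * expand 3 three_ne_zero cubicA - X * expand 3 three_ne_zero (dissect 1 cubicA) =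
      expand 3 three_ne_zero (2 * cubicA) * X ^ 0 -
        expand 3 three_ne_zero (dissect 1 cubicA) * X ^ 1 := by
    rw [map_mul, map_ofNat]
    ring
  rw [dissect_expand_mul (by norm_num), h2, map_sub, dissect_expand_mul (by norm_num),
    dissect_expand_mul (by norm_num), dissect_X_pow (by norm_num), dissect_X_pow (by norm_num),
    dissect_ofNat_mul, h1] at h
  norm_num at h
  rw [cubicC]
  linear_combination -eulerInv * h - dissect 1 cubicA * euler_mul_eulerInv

/-- `a(q³)` -/
noncomputable def cubicA₃ : ℤ⟦X⟧ := expand 3 three_ne_zero cubicA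

/-- `c(q³) / 3` -/
noncomputable def cubicC₃ : ℤ⟦X⟧ := X * expand 3 three_ne_zero cubicC

theorem cubicA_eq : cubicA = cubicA₃ + 6 * cubicC₃ := by
  conv_lhs => rw [cubicA_eq_expand_add, dissect_one_cubicA, map_mul, map_ofNat]
  rw [cubicA₃, cubicC₃]
  ring

theorem euler_cube_eq :
    euler ℤ ^ 3 = expand 3 three_ne_zero (euler ℤ) * (cubicA₃ - 3 * cubicC₃) := by
  have h := two_mul_euler_cube
  rw [dissect_one_cubicA, map_mul, map_ofNat] at h
  have h2 : (2 : ℤ⟦X⟧) ≠ 0 := by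
    intro h
    have := congrArg constantCoeff h
    rw [map_ofNat, map_zero] at this
    norm_num at this
  apply mul_left_cancel₀ h2
  rw [h, cubicA₃, cubicC₃]
  ring

theorem rescale_expand {K : Type*} [CommRing K] {u : K} (hu : u ^ 3 = 1) (f : K⟦X⟧) :
    rescale u (expand 3 three_ne_zero f) = expand 3 three_ne_zero f := by
  ext n
  rw [coeff_rescale, coeff_expand]
  split_ifs with h
  · obtain ⟨m, rfl⟩ := h
    rw [pow_mul, hu, one_pow, one_mul]
  · rw [mul_zero]

/-- The Borwein identity `a³ - c³ = b³`, at `q³`. -/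
theorem cubicA₃_cube_sub : expand 3 three_ne_zero (expand 3 three_ne_zero (euler ℤ)) ^ 3 *
    (cubicA₃ ^ 3 - 27 * cubicC₃ ^ 3) = expand 3 three_ne_zero (euler ℤ) ^ 9 := by
  obtain ⟨u, hu⟩ := exists_omega
  have hu3 : u ^ 3 = 1 := by linear_combination (u - 1) * hu
  have hu6 : (u ^ 2) ^ 3 = 1 := by rw [← pow_mul, mul_comm, pow_mul, hu3, one_pow]
  have hC : (C u : ℂ⟦X⟧) ^ 2 + C u + 1 = 0 := by
    rw [← map_one C, ← map_pow, ← map_add, ← map_add, hu, map_zero]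
  have hC3 : (C u : ℂ⟦X⟧) ^ 3 = 1 := by linear_combination (C u - 1) * hC
  have hne : expand 3 three_ne_zero (euler ℂ) ^ 3 ≠ 0 := by
    refine pow_ne_zero _ fun h => ?_
    have := congrArg constantCoeff h
    rw [constantCoeff_expand, constantCoeff_euler] at this
    simp at this
  have h0 := congrArg (PowerSeries.map (Int.castRingHom ℂ)) euler_cube_eq
  rw [cubicA₃, cubicC₃] at h0 ⊢
  apply map_intCast_injective
  simp only [map_mul, map_sub, map_pow, map_ofNat, map_expand, map_euler, PowerSeries.map_X] at h0 ⊢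
  generalize PowerSeries.map (Int.castRingHom ℂ) cubicA = a at h0 ⊢
  generalize PowerSeries.map (Int.castRingHom ℂ) cubicC = c at h0 ⊢
  -- Conjugation by `q ↦ ωq` fixes `A` and sends `D` to `ωD`, so the three conjugates of `A - 3D`
  -- multiply to `A³ - 27D³`.
  have h1 := congrArg (rescale u) h0
  have h2 := congrArg (rescale (u ^ 2)) h0
  simp only [map_mul, map_sub, map_pow, map_ofNat, rescale_X, rescale_expand hu3,
    rescale_expand hu6] at h1 h2
  have h3 := euler_mul_rescale_mul_rescale hu
  apply mul_left_cancel₀ hne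
  generalize euler ℂ = E at *
  generalize expand 3 three_ne_zero (expand 3 three_ne_zero E) = E9 at *
  generalize expand 3 three_ne_zero E = E3 at *
  generalize expand 3 three_ne_zero a = A at *
  generalize expand 3 three_ne_zero c = z at *
  have h4 := congrArg (· ^ 3) h3
  simp only [mul_pow] at h4
  rw [h0, h1, h2] at h4
  simp only [← pow_mul] at h4
  generalize (X : ℂ⟦X⟧) = x at *
  generalize (C u : ℂ⟦X⟧) = w at *
  linear_combination h4 + E9 ^ 3 * E3 ^ 3 * ((3 * A ^ 2 * (x * z) - 9 * A * (x * z) ^ 2 * w) * hC +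
    27 * (x * z) ^ 3 * hC3)

/-- `a(q³)² + a(q³) c(q³) + c(q³)²` -/
noncomputable def cubicS : ℤ⟦X⟧ := cubicA₃ ^ 2 + 3 * cubicA₃ * cubicC₃ + 9 * cubicC₃ ^ 2

/-- `cubicS` is the cofactor of `A - 3D` in `A³ - 27D³`, so it rationalizes the denominator in
`euler_cube_eq`. -/
theorem eulerInv_cube : eulerInv ^ 3 = expand 3 three_ne_zero
    (eulerInv ^ 10 * expand 3 three_ne_zero (euler ℤ) ^ 3) * cubicS := by
  have h1 := congrArg (expand 3 three_ne_zero) euler_mul_eulerInv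
  rw [map_mul, map_one] at h1
  have h2 := euler_cube_eq
  have h3 := cubicA₃_cube_sub
  have h4 := euler_mul_eulerInv
  rw [cubicS, map_mul, map_pow, map_pow]
  generalize expand 3 three_ne_zero (expand 3 three_ne_zero (euler ℤ)) = E9 at *
  generalize expand 3 three_ne_zero (euler ℤ) = E3 at *
  generalize expand 3 three_ne_zero eulerInv = e3 at *
  generalize cubicA₃ = A at *
  generalize cubicC₃ = D at *
  have h5 : E3 ^ 9 * e3 ^ 9 = 1 := by rw [← mul_pow, h1, one_pow]
  have h6 : euler ℤ ^ 3 * eulerInv ^ 3 = 1 := by rw [← mul_pow, h4, one_pow]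
  have h7 : euler ℤ ^ 3 * (e3 ^ 10 * E9 ^ 3 * (A ^ 2 + 3 * A * D + 9 * D ^ 2)) = 1 := by
    rw [h2]
    linear_combination e3 ^ 9 * E9 ^ 3 * (A ^ 3 - 27 * D ^ 3) * h1 + e3 ^ 9 * h3 + h5
  linear_combination -eulerInv ^ 3 * h7 +
    e3 ^ 10 * E9 ^ 3 * (A ^ 2 + 3 * A * D + 9 * D ^ 2) * h6

/-- `c(q)³ / 27` -/
noncomputable def cubicW : ℤ⟦X⟧ := X * cubicC ^ 3

theorem cubicW_eq : cubicW = cubicC₃ * cubicS := by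
  have h1 := congrArg (expand 3 three_ne_zero) euler_mul_eulerInv
  rw [map_mul, map_one] at h1
  have h2 := eulerInv_cube
  rw [map_mul, map_pow, map_pow] at h2
  rw [cubicW, cubicC₃, cubicC, mul_pow, h2, map_mul, map_pow]
  generalize expand 3 three_ne_zero (expand 3 three_ne_zero (euler ℤ)) = E9 at *
  generalize expand 3 three_ne_zero (euler ℤ) = E3 at *
  generalize expand 3 three_ne_zero eulerInv = e3 at *
  have h5 : E3 ^ 9 * e3 ^ 9 = 1 := by rw [← mul_pow, h1, one_pow]
  linear_combination X * e3 * E9 ^ 3 * cubicS * h5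

end CubicIdentities

/-! ### One dissection step on an eta quotient. -/

section Iteration

/-- The common shape of the generating functions in the progressions. -/
noncomputable def quotientForm (p n : ℕ) (f : ℤ⟦X⟧) : ℤ⟦X⟧ :=
  expand 3 three_ne_zero (euler ℤ) ^ p * eulerInv ^ (3 * n) * f

theorem quotientForm_eq (p n : ℕ) (f : ℤ⟦X⟧) : quotientForm p n f =
    expand 3 three_ne_zero (euler ℤ ^ p * eulerInv ^ (10 * n) *
      expand 3 three_ne_zero (euler ℤ) ^ (3 * n)) * (cubicS ^ n * f) := by
  rw [quotientForm, pow_mul eulerInv 3, eulerInv_cube]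
  simp only [map_mul, map_pow, mul_pow, ← pow_mul]
  ring

/-- Dissection of a monomial `a(q³)ᵐ (c(q³) / 3)ʲ` of a generating function. -/
theorem dissect_quotientForm_monomial {p n q s j m : ℕ} (hs : s < 3) (hq : p + q = 10 * n + s) :
    dissect s (expand 3 three_ne_zero (euler ℤ ^ p * eulerInv ^ (10 * n) *
      expand 3 three_ne_zero (euler ℤ) ^ (3 * n)) * (cubicA₃ ^ m * cubicC₃ ^ j)) =
    if j % 3 = s then expand 3 three_ne_zero (euler ℤ) ^ (3 * n + 3 * s) * eulerInv ^ q *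
      (cubicA ^ m * cubicW ^ (j / 3)) else 0 := by
  have h (f : ℤ⟦X⟧) : expand 3 three_ne_zero f * (cubicA₃ ^ m * cubicC₃ ^ j) =
      expand 3 three_ne_zero (f * (cubicA ^ m * cubicC ^ j)) * X ^ j := by
    rw [cubicA₃, cubicC₃, map_mul, map_mul, map_pow, map_pow]
    ring
  rw [h, dissect_expand_mul hs, dissect_X_pow hs, mul_ite, mul_zero]
  refine if_ctx_congr Iff.rfl (fun h => ?_) fun _ => rfl
  -- Each triple of factors `C` absorbs one `q` into `W`; the leftover `Cˢ` is an eta quotient and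
  -- joins the prefactor.
  have hj : cubicC ^ j * X ^ (j / 3) = cubicC ^ s * cubicW ^ (j / 3) := by
    rw [cubicW, mul_pow, ← pow_mul]
    nth_rewrite 1 [← Nat.div_add_mod j 3]
    rw [h, pow_add]
    ring
  have hC : cubicC ^ s = expand 3 three_ne_zero (euler ℤ) ^ (3 * s) * eulerInv ^ s := by
    rw [cubicC, mul_pow, pow_mul]
  have he := euler_pow_mul_eulerInv_pow hq
  rw [pow_add] at he
  rw [← he, pow_add]
  linear_combination euler ℤ ^ p * eulerInv ^ (10 * n) *
    expand 3 three_ne_zero (euler ℤ) ^ (3 * n) * cubicA ^ m * (hj + cubicW ^ (j / 3) * hC)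

end Iteration

/-! ### Expansions in `A` and `D` to the required 3-adic precision. -/

section PolynomialCongruences

variable {R : Type*} [CommRing R]

theorem exists_add_pow_eq (x y : R) (n : ℕ) :
    ∃ r, (x + y) ^ (n + 2) = x ^ (n + 2) + (n + 2 : ℕ) * x ^ (n + 1) * y +
      (n + 2).choose 2 * x ^ n * y ^ 2 + y ^ 3 * r := by
  induction n with
  | zero => exact ⟨0, by norm_num; ring⟩
  | succ n ih =>
    obtain ⟨r, hr⟩ := ih
    refine ⟨r * (x + y) + (n + 2).choose 2 * x ^ n, ?_⟩
    rw [pow_succ, hr, show n + 1 + 2 = (n + 2) + 1 by ring, Nat.choose_succ_succ' (n + 2) 1,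
      Nat.choose_one_right]
    push_cast
    ring

theorem exists_add_mul_pow_eq (m x y : R) (n : ℕ) : ∃ r, (x + m * y) ^ n = x ^ n + m * r := by
  obtain ⟨r, hr⟩ := sub_dvd_pow_sub_pow (x + m * y) x n
  exact ⟨y * r, by linear_combination hr⟩

/-- Since `(A + 6D) S ≡ A³` mod 9, pairing these factors makes high powers collapse 3-adically. -/
theorem add_mul_eq_cube_add (A D : R) :
    (A + 6 * D) * (A ^ 2 + 3 * A * D + 9 * D ^ 2) =
      A ^ 3 + 9 * (A ^ 2 * D + 3 * (A * D ^ 2) + 6 * D ^ 3) := by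
  ring

theorem quadratic_pow_four_mul_eq (A D Z : R) :
    Z * ((A ^ 2 + 3 * A * D + 9 * D ^ 2) ^ 4 * (A + 6 * D)) =
      Z * (A ^ 9 * D ^ 0) + 18 * (Z * (A ^ 8 * D ^ 1)) + 162 * (Z * (A ^ 7 * D ^ 2)) +
      972 * (Z * (A ^ 6 * D ^ 3)) + 4131 * (Z * (A ^ 5 * D ^ 4)) +
      13122 * (Z * (A ^ 4 * D ^ 5)) + 30618 * (Z * (A ^ 3 * D ^ 6)) +
      52488 * (Z * (A ^ 2 * D ^ 7)) + 59049 * (Z * (A ^ 1 * D ^ 8)) +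
      39366 * (Z * (A ^ 0 * D ^ 9)) := by
  ring

/-- The powers already split off contribute `3⁷`, so precision `2187 = 3⁷` reaches `3¹⁴`. -/
theorem exists_quadratic_pow_eleven_mul_eq (A D Z : R) :
    ∃ r, Z * ((A ^ 2 + 3 * A * D + 9 * D ^ 2) ^ 11 * (2 * (A + 6 * D) ^ 7 +
      162 * ((A + 6 * D) ^ 4 * (D * (A ^ 2 + 3 * A * D + 9 * D ^ 2))) +
      729 * ((A + 6 * D) * (D * (A ^ 2 + 3 * A * D + 9 * D ^ 2)) ^ 2))) =
      2 * (Z * (A ^ 29 * D ^ 0)) + 312 * (Z * (A ^ 28 * D ^ 1)) +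
      15921 * (Z * (A ^ 27 * D ^ 2)) + 451251 * (Z * (A ^ 26 * D ^ 3)) +
      8690409 * (Z * (A ^ 25 * D ^ 4)) + 125691264 * (Z * (A ^ 24 * D ^ 5)) +
      1446707061 * (Z * (A ^ 23 * D ^ 6)) +
      2187 * r := by
  refine ⟨Z * (6287463 * (A ^ 22 * D ^ 7) + 50605533 * (A ^ 21 * D ^ 8) +
        351104490 * (A ^ 20 * D ^ 9) + 2127287448 * (A ^ 19 * D ^ 10) +
        11363994144 * (A ^ 18 * D ^ 11) + 53904887316 * (A ^ 17 * D ^ 12) +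
        228220225326 * (A ^ 16 * D ^ 13) + 865489243347 * (A ^ 15 * D ^ 14) +
        2946582832311 * (A ^ 14 * D ^ 15) + 9014968137573 * (A ^ 13 * D ^ 16) +
        24781711364442 * (A ^ 12 * D ^ 17) + 61127668170972 * (A ^ 11 * D ^ 18) +
        134941438854684 * (A ^ 10 * D ^ 19) + 265507679137140 * (A ^ 9 * D ^ 20) +
        462894907583394 * (A ^ 8 * D ^ 21) + 709279229188323 * (A ^ 7 * D ^ 22) +
        944479625256963 * (A ^ 6 * D ^ 23) + 1075925198446839 * (A ^ 5 * D ^ 24) +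
        1025135534600406 * (A ^ 4 * D ^ 25) + 789536999409237 * (A ^ 3 * D ^ 26) +
        464840662419315 * (A ^ 2 * D ^ 27) + 188234055887985 * (A ^ 1 * D ^ 28) +
        40230518418738 * (A ^ 0 * D ^ 29)), ?_⟩
  ring

/-- Precision `3⁶` suffices after `3⁸`. In `((A + 6D) S)²⁸ S³` the second-order expansion is enough,
as `9³ = 729`; `2896803 = 3⁵ · 11921` leaves the other term to be known only mod 3, where `S ≡ A²`.
-/
theorem exists_quadratic_pow_thirtyOne_mul_eq (A D Z : R) :
    ∃ r, Z * ((A ^ 2 + 3 * A * D + 9 * D ^ 2) ^ 31 * (104 * (A + 6 * D) ^ 28 + 2896803 *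
      ((A + 6 * D) ^ 25 * (D * (A ^ 2 + 3 * A * D + 9 * D ^ 2))))) =
      104 * (Z * (A ^ 90 * D ^ 0)) + 657 * (Z * (A ^ 89 * D ^ 1)) + 81 * (Z * (A ^ 88 * D ^ 2)) +
        486 * (Z * (A ^ 87 * D ^ 3)) + 243 * (Z * (A ^ 86 * D ^ 4)) + 729 * r := by
  have h := add_mul_eq_cube_add A D
  obtain ⟨r₁, h₁⟩ := exists_add_pow_eq (A ^ 3) (9 * (A ^ 2 * D + 3 * (A * D ^ 2) + 6 * D ^ 3)) 26
  obtain ⟨r₂, h₂⟩ := exists_add_mul_pow_eq 9 (A ^ 3) (A ^ 2 * D + 3 * (A * D ^ 2) + 6 * D ^ 3) 25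
  obtain ⟨r₃, h₃⟩ := exists_add_mul_pow_eq 3 (A ^ 2) (A * D + 3 * D ^ 2) 7
  rw [← h] at h₁ h₂
  rw [show A ^ 2 + 3 * (A * D + 3 * D ^ 2) = A ^ 2 + 3 * A * D + 9 * D ^ 2 by ring] at h₃
  norm_num [Nat.choose] at h₁
  have e : 104 * ((A ^ 3) ^ 28 + 28 * (A ^ 3) ^ 27 *
      (9 * (A ^ 2 * D + 3 * (A * D ^ 2) + 6 * D ^ 3)) + 378 * (A ^ 3) ^ 26 *
      (9 * (A ^ 2 * D + 3 * (A * D ^ 2) + 6 * D ^ 3)) ^ 2) *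
      (A ^ 2 + 3 * A * D + 9 * D ^ 2) ^ 3 + 2896803 * (A ^ 3) ^ 25 * D * (A ^ 2) ^ 7 =
      104 * (A ^ 90 * D ^ 0) + 657 * (A ^ 89 * D ^ 1) + 81 * (A ^ 88 * D ^ 2) +
        486 * (A ^ 87 * D ^ 3) + 243 * (A ^ 86 * D ^ 4) + 729 * (4010 * (A ^ 89 * D ^ 1) + 4807 * (A ^ 88 * D ^ 2) + 68674 * (A ^ 87 * D ^ 3) +
    578101 * (A ^ 86 * D ^ 4) + 3273192 * (A ^ 85 * D ^ 5) + 13721448 * (A ^ 84 * D ^ 6) +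
    43374240 * (A ^ 83 * D ^ 7) + 105316848 * (A ^ 82 * D ^ 8) +
    192274992 * (A ^ 81 * D ^ 9) + 257926032 * (A ^ 80 * D ^ 10) +
    229267584 * (A ^ 79 * D ^ 11) + 114633792 * (A ^ 78 * D ^ 12)) := by
    ring
  generalize 4010 * (A ^ 89 * D ^ 1) + 4807 * (A ^ 88 * D ^ 2) + 68674 * (A ^ 87 * D ^ 3) +
    578101 * (A ^ 86 * D ^ 4) + 3273192 * (A ^ 85 * D ^ 5) + 13721448 * (A ^ 84 * D ^ 6) +
    43374240 * (A ^ 83 * D ^ 7) + 105316848 * (A ^ 82 * D ^ 8) +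
    192274992 * (A ^ 81 * D ^ 9) + 257926032 * (A ^ 80 * D ^ 10) +
    229267584 * (A ^ 79 * D ^ 11) + 114633792 * (A ^ 78 * D ^ 12) = t at e
  generalize A ^ 2 * D + 3 * (A * D ^ 2) + 6 * D ^ 3 = V at *
  generalize A ^ 2 + 3 * A * D + 9 * D ^ 2 = S at *
  generalize A + 6 * D = U at *
  refine ⟨Z * (t + 104 * V ^ 3 * r₁ * S ^ 3 +
    11921 * D * ((A ^ 3) ^ 25 * r₃ + 3 * r₂ * (A ^ 2) ^ 7 + 9 * r₂ * r₃)), ?_⟩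
  linear_combination Z * (104 * S ^ 3 * h₁ + 2896803 * D * (S ^ 7 * h₂ +
    ((A ^ 3) ^ 25 + 9 * r₂) * h₃) + e)

/-- By now `3¹²` has been split off, so precision 9 suffices; the product is `((A + 6D) S)⁸⁸ S⁴`. -/
theorem exists_quadratic_pow_ninetyTwo_mul_eq (A D Z : R) :
    ∃ r, Z * ((A ^ 2 + 3 * A * D + 9 * D ^ 2) ^ 92 * (A + 6 * D) ^ 88) =
      Z * (A ^ 272 * D ^ 0) + 12 * (Z * (A ^ 271 * D ^ 1)) + 9 * r := by
  obtain ⟨r, h⟩ := exists_add_mul_pow_eq 9 (A ^ 3) (A ^ 2 * D + 3 * (A * D ^ 2) + 6 * D ^ 3) 88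
  rw [← add_mul_eq_cube_add A D] at h
  have e : (A ^ 3) ^ 88 * (A ^ 2 + 3 * A * D + 9 * D ^ 2) ^ 4 =
      A ^ 272 * D ^ 0 + 12 * (A ^ 271 * D ^ 1) + 9 * (A ^ 264 * (10 * A ^ 6 * D ^ 2 +
        48 * A ^ 5 * D ^ 3 + 171 * A ^ 4 * D ^ 4 + 432 * A ^ 3 * D ^ 5 + 810 * A ^ 2 * D ^ 6 +
        972 * A * D ^ 7 + 729 * D ^ 8)) := by
    ring
  generalize A ^ 264 * (10 * A ^ 6 * D ^ 2 + 48 * A ^ 5 * D ^ 3 + 171 * A ^ 4 * D ^ 4 +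
    432 * A ^ 3 * D ^ 5 + 810 * A ^ 2 * D ^ 6 + 972 * A * D ^ 7 + 729 * D ^ 8) = t at e
  generalize A ^ 2 + 3 * A * D + 9 * D ^ 2 = S at *
  generalize A + 6 * D = U at *
  refine ⟨Z * (t + r * S ^ 4), ?_⟩
  linear_combination Z * (S ^ 4 * h + e)

end PolynomialCongruences

/-! ### The chain of dissections and its powers of 3. -/

section Chain

/-- The generating function of `cphi 3`. -/
noncomputable def cphiSeries : ℤ⟦X⟧ := PowerSeries.mk fun n => (cphi 3 n : ℤ)

theorem cphiSeries_eq : cphiSeries = quotientForm 0 1 cubicA := by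
  have h := euler_cube_mul_mk_cphi
  rw [qfSeries_one] at h
  have h6 : euler ℤ ^ 3 * eulerInv ^ 3 = 1 := by
    rw [← mul_pow, euler_mul_eulerInv, one_pow]
  rw [quotientForm, cphiSeries]
  linear_combination eulerInv ^ 3 * h - PowerSeries.mk (fun n => (cphi 3 n : ℤ)) * h6

/-- In this and the next four dissections `q = 10n + s - p`; the resulting form has parameters `3n +
3s` and `q / 3`. -/
theorem dissect_quotientForm_0_1 : 9 ∣ dissect 1 (quotientForm 0 1 cubicA) ∧
    dissect 2 (quotientForm 0 1 cubicA) = 27 * quotientForm 9 4 cubicA := by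
  have hZ₁ (m j : ℕ) := dissect_quotientForm_monomial (p := 0) (n := 1) (q := 11) (s := 1) (j := j)
    (m := m) (by norm_num) rfl
  have hZ₂ (m j : ℕ) := dissect_quotientForm_monomial (p := 0) (n := 1) (q := 12) (s := 2) (j := j)
    (m := m) (by norm_num) rfl
  have h := quotientForm_eq 0 1 cubicA
  generalize expand 3 three_ne_zero (euler ℤ ^ 0 * eulerInv ^ (10 * 1) *
      expand 3 three_ne_zero (euler ℤ) ^ (3 * 1)) = Z at *
  have hP : Z * (cubicS ^ 1 * cubicA) = Z * (cubicA₃ ^ 3 * cubicC₃ ^ 0) +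
      9 * (Z * (cubicA₃ ^ 2 * cubicC₃ ^ 1)) + 27 * (Z * (cubicA₃ ^ 1 * cubicC₃ ^ 2)) +
      54 * (Z * (cubicA₃ ^ 0 * cubicC₃ ^ 3)) := by
    rw [cubicS, cubicA_eq]
    ring
  rw [h, hP]
  simp only [map_add, dissect_ofNat_mul, hZ₁, hZ₂]
  norm_num [quotientForm]

theorem dissect_quotientForm_9_4 : 9 ∣ dissect 1 (quotientForm 9 4 cubicA) ∧
    dissect 2 (quotientForm 9 4 cubicA) = 81 * quotientForm 18 11
      (2 * cubicA ^ 7 + 162 * (cubicA ^ 4 * cubicW) + 729 * (cubicA * cubicW ^ 2)) := by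
  have hZ₁ (m j : ℕ) := dissect_quotientForm_monomial (p := 9) (n := 4) (q := 32) (s := 1) (j := j)
    (m := m) (by norm_num) rfl
  have hZ₂ (m j : ℕ) := dissect_quotientForm_monomial (p := 9) (n := 4) (q := 33) (s := 2) (j := j)
    (m := m) (by norm_num) rfl
  have h := quotientForm_eq 9 4 cubicA
  generalize expand 3 three_ne_zero (euler ℤ ^ 9 * eulerInv ^ (10 * 4) *
      expand 3 three_ne_zero (euler ℤ) ^ (3 * 4)) = Z at *
  have hP := quadratic_pow_four_mul_eq cubicA₃ cubicC₃
  rw [← cubicA_eq] at hP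
  change ∀ Z, Z * (cubicS ^ 4 * cubicA) = _ at hP
  rw [hP] at h
  rw [h]
  simp only [map_add, dissect_ofNat_mul, hZ₁, hZ₂]
  norm_num [quotientForm]
  constructor
  · exact dvd_add (dvd_add (dvd_mul_of_dvd_left (Dvd.intro 2 (by norm_num)) _)
      (dvd_mul_of_dvd_left (Dvd.intro 459 (by norm_num)) _))
      (dvd_mul_of_dvd_left (Dvd.intro 5832 (by norm_num)) _)
  · ring

/-- The chain continues with residue 1 here: `j = 1` and `j = 4` survive, with coefficients `312 = 3
· 104` and `8690409 = 3 · 2896803`. -/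
theorem dissect_quotientForm_18_11 : (∃ R, dissect 1 (quotientForm 18 11
      (2 * cubicA ^ 7 + 162 * (cubicA ^ 4 * cubicW) + 729 * (cubicA * cubicW ^ 2))) =
      3 * quotientForm 36 31 (104 * cubicA ^ 28 + 2896803 * (cubicA ^ 25 * cubicW)) + 2187 * R) ∧
    9 ∣ dissect 2 (quotientForm 18 11
      (2 * cubicA ^ 7 + 162 * (cubicA ^ 4 * cubicW) + 729 * (cubicA * cubicW ^ 2))) := by
  have hZ₁ (m j : ℕ) := dissect_quotientForm_monomial (p := 18) (n := 11) (q := 93) (s := 1)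
    (j := j) (m := m) (by norm_num) rfl
  have hZ₂ (m j : ℕ) := dissect_quotientForm_monomial (p := 18) (n := 11) (q := 94) (s := 2)
    (j := j) (m := m) (by norm_num) rfl
  have h := quotientForm_eq 18 11
      (2 * cubicA ^ 7 + 162 * (cubicA ^ 4 * cubicW) + 729 * (cubicA * cubicW ^ 2))
  generalize expand 3 three_ne_zero (euler ℤ ^ 18 * eulerInv ^ (10 * 11) *
      expand 3 three_ne_zero (euler ℤ) ^ (3 * 11)) = Z at *
  have hP := exists_quadratic_pow_eleven_mul_eq cubicA₃ cubicC₃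
  rw [← cubicA_eq] at hP
  change ∀ Z, ∃ r, Z * (cubicS ^ 11 * (2 * cubicA ^ 7 + 162 * (cubicA ^ 4 * (cubicC₃ * cubicS)) +
    729 * (cubicA * (cubicC₃ * cubicS) ^ 2))) = _ at hP
  rw [← cubicW_eq] at hP
  obtain ⟨r, hr⟩ := hP Z
  rw [hr] at h
  rw [h]
  simp only [map_add, dissect_ofNat_mul, hZ₁, hZ₂]
  norm_num [quotientForm]
  constructor
  · exact ⟨dissect 1 r, by ring⟩
  · exact dvd_add (dvd_add (dvd_mul_of_dvd_left (Dvd.intro 1769 (by norm_num)) _)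
      (dvd_mul_of_dvd_left (Dvd.intro 13965696 (by norm_num)) _))
      (dvd_mul_of_dvd_left (Dvd.intro 243 (by norm_num)) _)

theorem dissect_quotientForm_36_31 : 9 ∣ dissect 1 (quotientForm 36 31
      (104 * cubicA ^ 28 + 2896803 * (cubicA ^ 25 * cubicW))) ∧
    ∃ R, dissect 2 (quotientForm 36 31
      (104 * cubicA ^ 28 + 2896803 * (cubicA ^ 25 * cubicW))) =
      81 * quotientForm 99 92 (cubicA ^ 88) + 729 * R := by
  have hZ₁ (m j : ℕ) := dissect_quotientForm_monomial (p := 36) (n := 31) (q := 275) (s := 1)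
    (j := j) (m := m) (by norm_num) rfl
  have hZ₂ (m j : ℕ) := dissect_quotientForm_monomial (p := 36) (n := 31) (q := 276) (s := 2)
    (j := j) (m := m) (by norm_num) rfl
  have h := quotientForm_eq 36 31 (104 * cubicA ^ 28 + 2896803 * (cubicA ^ 25 * cubicW))
  generalize expand 3 three_ne_zero (euler ℤ ^ 36 * eulerInv ^ (10 * 31) *
      expand 3 three_ne_zero (euler ℤ) ^ (3 * 31)) = Z at *
  have hP := exists_quadratic_pow_thirtyOne_mul_eq cubicA₃ cubicC₃
  rw [← cubicA_eq] at hP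
  change ∀ Z, ∃ r, Z * (cubicS ^ 31 * (104 * cubicA ^ 28 +
    2896803 * (cubicA ^ 25 * (cubicC₃ * cubicS)))) = _ at hP
  rw [← cubicW_eq] at hP
  obtain ⟨r, hr⟩ := hP Z
  rw [hr] at h
  rw [h]
  simp only [map_add, dissect_ofNat_mul, hZ₁, hZ₂]
  norm_num [quotientForm]
  exact dvd_add (dvd_add (dvd_mul_of_dvd_left (Dvd.intro 73 (by norm_num)) _)
    (dvd_mul_of_dvd_left (Dvd.intro 27 (by norm_num)) _))
    (dvd_mul_of_dvd_left (Dvd.intro 81 (by norm_num)) _)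

theorem dissect_quotientForm_99_92 : 3 ∣ dissect 1 (quotientForm 99 92 (cubicA ^ 88)) ∧
    9 ∣ dissect 2 (quotientForm 99 92 (cubicA ^ 88)) := by
  have hZ₁ (m j : ℕ) := dissect_quotientForm_monomial (p := 99) (n := 92) (q := 822) (s := 1)
    (j := j) (m := m) (by norm_num) rfl
  have hZ₂ (m j : ℕ) := dissect_quotientForm_monomial (p := 99) (n := 92) (q := 823) (s := 2)
    (j := j) (m := m) (by norm_num) rfl
  have h := quotientForm_eq 99 92 (cubicA ^ 88)
  generalize expand 3 three_ne_zero (euler ℤ ^ 99 * eulerInv ^ (10 * 92) *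
      expand 3 three_ne_zero (euler ℤ) ^ (3 * 92)) = Z at *
  have hP := exists_quadratic_pow_ninetyTwo_mul_eq cubicA₃ cubicC₃
  rw [← cubicA_eq] at hP
  change ∀ Z, ∃ r, Z * (cubicS ^ 92 * cubicA ^ 88) = _ at hP
  obtain ⟨r, hr⟩ := hP Z
  rw [hr] at h
  rw [h]
  simp only [map_add, dissect_ofNat_mul, hZ₁, hZ₂]
  norm_num
  exact dvd_add (dvd_mul_of_dvd_left (Dvd.intro 4 (by norm_num)) _)
    (dvd_mul_of_dvd_left (Dvd.intro 3 (by norm_num)) _)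

theorem natCast_dvd_coeff {m : ℕ} {f : ℤ⟦X⟧} (h : (m : ℤ⟦X⟧) ∣ f) (n : ℕ) :
    (m : ℤ) ∣ coeff n f := by
  obtain ⟨g, rfl⟩ := h
  rw [← nsmul_eq_mul, map_nsmul, nsmul_eq_mul]
  exact dvd_mul_right _ _

theorem cphi_modEq_of_dvd_dissect {f : ℤ⟦X⟧} {r n k m : ℕ} (h : (m : ℤ⟦X⟧) ∣ dissect r f)
    (hf : coeff (3 * n + r) f = (cphi 3 k : ℤ)) : cphi 3 k ≡ 0 [MOD m] := by
  rw [Nat.modEq_zero_iff_dvd, ← Int.natCast_dvd_natCast, ← hf, ← coeff_dissect]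
  exact natCast_dvd_coeff h n

theorem pow_dvd_dissect_mod_three : ((3 ^ 2 : ℕ) : ℤ⟦X⟧) ∣ dissect 1 cphiSeries ∧
    ((3 ^ 3 : ℕ) : ℤ⟦X⟧) ∣ dissect 2 cphiSeries := by
  rw [cphiSeries_eq]
  obtain ⟨h1, h2⟩ := dissect_quotientForm_0_1
  rw [h2]
  norm_num
  exact h1

theorem pow_dvd_dissect_mod_nine : ((3 ^ 5 : ℕ) : ℤ⟦X⟧) ∣ dissect 1 (dissect 2 cphiSeries) ∧
    ((3 ^ 7 : ℕ) : ℤ⟦X⟧) ∣ dissect 2 (dissect 2 cphiSeries) := by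
  rw [cphiSeries_eq, dissect_quotientForm_0_1.2, dissect_ofNat_mul, dissect_ofNat_mul]
  obtain ⟨⟨R, h1⟩, h2⟩ := dissect_quotientForm_9_4
  rw [h2, h1]
  constructor
  · exact ⟨R, by push_cast; ring⟩
  · exact ⟨_, by push_cast; ring⟩

theorem pow_dvd_dissect_mod_twentySeven : ((3 ^ 8 : ℕ) : ℤ⟦X⟧) ∣ dissect 1 (dissect 2 (dissect 2 cphiSeries)) ∧
    ((3 ^ 9 : ℕ) : ℤ⟦X⟧) ∣ dissect 2 (dissect 2 (dissect 2 cphiSeries)) := by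
  rw [cphiSeries_eq, dissect_quotientForm_0_1.2]
  simp only [dissect_ofNat_mul, dissect_quotientForm_9_4.2]
  obtain ⟨⟨R, h1⟩, ⟨R', h2⟩⟩ := dissect_quotientForm_18_11
  rw [h2, h1]
  constructor
  · exact ⟨quotientForm 36 31 (104 * cubicA ^ 28 + 2896803 * (cubicA ^ 25 * cubicW)) + 729 * R,
      by push_cast; ring⟩
  · exact ⟨R', by push_cast; ring⟩

/-- Here `6561 = 3⁸` and `4782969 = 3¹⁴`, so the remainder is harmless in all later congruences. -/
theorem dissect_one_two_two_cphiSeries :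
    ∃ R, dissect 1 (dissect 2 (dissect 2 cphiSeries)) =
      6561 * quotientForm 36 31 (104 * cubicA ^ 28 + 2896803 * (cubicA ^ 25 * cubicW)) +
        4782969 * R := by
  rw [cphiSeries_eq, dissect_quotientForm_0_1.2]
  simp only [dissect_ofNat_mul, dissect_quotientForm_9_4.2]
  obtain ⟨⟨R, h1⟩, -⟩ := dissect_quotientForm_18_11
  exact ⟨R, by rw [h1]; ring⟩

theorem pow_dvd_dissect_mod_eightyOne :
    ((3 ^ 10 : ℕ) : ℤ⟦X⟧) ∣ dissect 1 (dissect 1 (dissect 2 (dissect 2 cphiSeries))) ∧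
    ((3 ^ 12 : ℕ) : ℤ⟦X⟧) ∣ dissect 2 (dissect 1 (dissect 2 (dissect 2 cphiSeries))) := by
  obtain ⟨R, hR⟩ := dissect_one_two_two_cphiSeries
  obtain ⟨⟨S, h1⟩, ⟨S', h2⟩⟩ := dissect_quotientForm_36_31
  simp only [hR, map_add, dissect_ofNat_mul, h1, h2]
  constructor
  · exact ⟨S + 81 * dissect 1 R, by push_cast; ring⟩
  · exact ⟨quotientForm 99 92 (cubicA ^ 88) + 9 * S' + 9 * dissect 2 R, by push_cast; ring⟩

theorem pow_dvd_dissect_mod_twoFortyThree :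
    ((3 ^ 13 : ℕ) : ℤ⟦X⟧) ∣ dissect 1 (dissect 2 (dissect 1 (dissect 2 (dissect 2 cphiSeries)))) ∧
    ((3 ^ 14 : ℕ) : ℤ⟦X⟧) ∣ dissect 2 (dissect 2 (dissect 1 (dissect 2 (dissect 2 cphiSeries)))) := by
  obtain ⟨R, hR⟩ := dissect_one_two_two_cphiSeries
  obtain ⟨-, ⟨S, h2⟩⟩ := dissect_quotientForm_36_31
  obtain ⟨⟨T, h3⟩, ⟨T', h4⟩⟩ := dissect_quotientForm_99_92
  simp only [hR, map_add, dissect_ofNat_mul, h2, h3, h4]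
  constructor
  · exact ⟨T + 3 * dissect 1 S + 3 * dissect 1 (dissect 2 R), by push_cast; ring⟩
  · exact ⟨T' + dissect 2 S + dissect 2 (dissect 2 R), by push_cast; ring⟩

end Chain

end ColoredFrobenius

theorem theorem1 (n : ℕ) :
    cphi 3 (3 * n + 1) ≡ 0 [MOD 3 ^ 2] ∧
    cphi 3 (3 * n + 2) ≡ 0 [MOD 3 ^ 3] ∧
    cphi 3 (9 * n + 5) ≡ 0 [MOD 3 ^ 5] ∧
    cphi 3 (9 * n + 8) ≡ 0 [MOD 3 ^ 7] ∧
    cphi 3 (27 * n + 17) ≡ 0 [MOD 3 ^ 8] ∧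
    cphi 3 (27 * n + 26) ≡ 0 [MOD 3 ^ 9] ∧
    cphi 3 (81 * n + 44) ≡ 0 [MOD 3 ^ 10] ∧
    cphi 3 (81 * n + 71) ≡ 0 [MOD 3 ^ 12] ∧
    cphi 3 (243 * n + 152) ≡ 0 [MOD 3 ^ 13] ∧
    cphi 3 (243 * n + 233) ≡ 0 [MOD 3 ^ 14] := by
  open ColoredFrobenius in
  refine ⟨cphi_modEq_of_dvd_dissect (n := n) pow_dvd_dissect_mod_three.1 ?_,
    cphi_modEq_of_dvd_dissect (n := n) pow_dvd_dissect_mod_three.2 ?_,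
    cphi_modEq_of_dvd_dissect (n := n) pow_dvd_dissect_mod_nine.1 ?_,
    cphi_modEq_of_dvd_dissect (n := n) pow_dvd_dissect_mod_nine.2 ?_,
    cphi_modEq_of_dvd_dissect (n := n) pow_dvd_dissect_mod_twentySeven.1 ?_,
    cphi_modEq_of_dvd_dissect (n := n) pow_dvd_dissect_mod_twentySeven.2 ?_,
    cphi_modEq_of_dvd_dissect (n := n) pow_dvd_dissect_mod_eightyOne.1 ?_,
    cphi_modEq_of_dvd_dissect (n := n) pow_dvd_dissect_mod_eightyOne.2 ?_,
    cphi_modEq_of_dvd_dissect (n := n) pow_dvd_dissect_mod_twoFortyThree.1 ?_,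
    cphi_modEq_of_dvd_dissect (n := n) pow_dvd_dissect_mod_twoFortyThree.2 ?_⟩ <;>
  -- The innermost extraction acts first: `dissect r (dissect s f)` reads the exponents `9n + 3r +
  -- s`.
  simp only [coeff_dissect, cphiSeries, PowerSeries.coeff_mk] <;> congr 2 <;> ring
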